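/- **Setting.** Let $T\in(0,\infty)$, $d\ge 1$, and let $\mathbb{I}_q=\{1,\dots,q\}$ be a finite set of regimes. Let $b:\mathbb{R}^d\to\mathbb{R}^d$, $\sigma:\mathbb{R}^d\to\mathbb{R}^{d\times d}$, and $f_i,g_i,c_{ij}:\mathbb{R}^d\to\mathbb{R}$ ($i,j\in\mathbb{I}_q$) be Lipschitz continuous, with $c_{ii}=0$, $\inf_x c_{ij}(x)>0$ for $j\ne i$, $\inf_x[c_{ij}(x)+c_{jk}(x)-c_{ik}(x)]>0$ for $j\neq i,k$, and $g_i\ge \max_j[g_j-c_{ij}]$. On a filtered probability space $(\Omega,\mathcal F,(\mathcal F_t)_{t\ge0},\mathbb P)$ let $W$ be a standard $d$-dimensional Brownian motion and $X_0$ an $\mathcal F_0$-measurable $\mathbb{R}^d$-valued random variable. For an integer $m\ge1$ with $h=T/m\le 1$, put $t_k=kh$ and $\vartheta_{k+1}=(W_{t_{k+1}}-W_{t_k})/\sqrt h$. Let $\bar X$ be the Euler scheme $\bar X_0=X_0$, $\bar X_{t_{k+1}}=\bar X_{t_k}+b(\bar X_{t_k})h+\sigma(\bar X_{t_k})\sqrt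 h\,\vartheta_{k+1}$, and let $\bar X^{t_k,x}$ be the same scheme started from $x\in\mathbb{R}^d$ at time $t_k$. **Value functions.** Let $\mathcal A^h_{t_k,i}$ be the set of switching controls $\alpha=(\tau_n,\iota_n)_{n\ge0}$, where $(\tau_n)$ is a nondecreasing sequence of stopping times with values in $\{t_k,\dots,t_m\}\cup\{\infty\}$, $\iota_n$ is an $\mathcal F_{\tau_n}$-measurable $\mathbb{I}_q$-valued random variable, $\tau_0=t_k$, $\iota_0=i$, and almost surely $\tau_n>T$ for some $n$. Let $N(\alpha)=\#\{n\ge1:\tau_n\le T\}$ and $I_t=\iota_n$ for $\tau_n\le t<\tau_{n+1}$. Define $$\bar v_i(t_k,x)=\sup_{\alpha\in\mathcal A^h_{t_k,i}}\mathbb E\Big[\sum_{\ell=k}^{m-1}f_{I_{t_\ell}}(\bar X^{t_k,x}_{t_\ell})h+g_{I_{t_m}}(\bar X^{t_k,x}_{t_m})-\sum_{n=1}^{N(\alpha)}c_{\iota_{n-1}\iota_n}(\bar X^{t_k,x}_{\tau_n})\Big],\qquad \bar Y^i_{t_k}=\bar v_i(t_k,\bar X_{t_k}).$$ **Quantization tree.**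 For $k=0,\dots,m$ let $\Gamma_k\subset\mathbb{R}^d$ be a finite nonempty grid, $\mathrm{Proj}_k$ a Borel closest neighbour projection on $\Gamma_k$, and $\hat X_k=\mathrm{Proj}_k(\bar X_{t_k})$. Define $\hat v^i_m=g_i$ and, for $k=m-1,\dots,0$ and $x\in\Gamma_k$, $$\hat v^i_k(x)=\max_{j\in\mathbb{I}_q}\Big[\sum_{y\in\Gamma_{k+1}}\mathbb P[\hat X_{k+1}=y\mid\hat X_k=x]\,\hat v^j_{k+1}(y)+hf_j(x)-c_{ij}(x)\Big],\qquad \hat Y^i_k=\hat v^i_k(\hat X_k).$$ **Theorem.** There exists a constant $K>0$, depending only on $d,q,T,b,\sigma,f,g,c$ (in particular not on $h$, the probability space, $X_0$, the grids, $k$, or $p,r,s$), such that $$\max_{i\in\mathbb I_q}\|\bar Y^i_{t_k}-\hat Y^i_k\|_p\le K\sum_{\ell=k}^m\big(1+\|X_0\|_r+\|\hat X_\ell\|_r\big)\,\|\bar X_{t_\ell}-\hat X_\ell\|_s$$ for all $k=0,\dots,m$ and all $p,r,s\in(1,\infty)$ with $\frac1p=\frac1r+\frac1s$. Here $\|Y\|_p=(\mathbb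 E|Y|^p)^{1/p}\in[0,\infty]$, with $0\cdot\infty=0$. -/

import Mathlib

open MeasureTheory ProbabilityTheory
open scoped NNReal ENNReal

noncomputable section

namespace Switching

/-- `ℝ^d` with its Euclidean norm. -/
abbrev Vec (d : ℕ) : Type := EuclideanSpace ℝ (Fin d)

/-- The data of an optimal switching problem with regimes `Fin q`, whose state process in `ℝ^d` is
not controlled: drift `b`, diffusion coefficient `σ` (its values are `d × d` matrices, seen as
linear maps of `ℝ^d`), running rewards `f i`, terminal gains `g i`, and costs `c i j` for
switching from regime `i` to regime `j`. -/
structure Model (d q : ℕ) where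
  b : Vec d → Vec d
  σ : Vec d → (Vec d →L[ℝ] Vec d)
  f : Fin q → Vec d → ℝ
  g : Fin q → Vec d → ℝ
  c : Fin q → Fin q → Vec d → ℝ

/-- The standing assumptions on the data. -/
structure Model.Standing {d q : ℕ} (M : Model d q) : Prop where
  lipschitz_b : ∃ L : ℝ≥0, LipschitzWith L M.b
  lipschitz_σ : ∃ L : ℝ≥0, LipschitzWith L M.σ
  lipschitz_f : ∀ i, ∃ L : ℝ≥0, LipschitzWith L (M.f i)
  lipschitz_g : ∀ i, ∃ L : ℝ≥0, LipschitzWith L (M.g i)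
  lipschitz_c : ∀ i j, ∃ L : ℝ≥0, LipschitzWith L (M.c i j)
  cost_self : ∀ i x, M.c i i x = 0
  /-- `inf_x c_ij(x) > 0` for `j ≠ i` -/
  cost_pos : ∀ i j, j ≠ i → ∃ δ : ℝ, 0 < δ ∧ ∀ x, δ ≤ M.c i j x
  /-- `inf_x [c_ij(x) + c_jk(x) - c_ik(x)] > 0` for `j ≠ i, k` -/
  cost_triangle : ∀ i j k, j ≠ i → j ≠ k →
    ∃ δ : ℝ, 0 < δ ∧ ∀ x, δ ≤ M.c i j x + M.c j k x - M.c i k x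
  /-- `g_i ≥ max_j (g_j - c_ij)` -/
  terminal : ∀ i j x, M.g j x - M.c i j x ≤ M.g i x

/-- `W` is a standard `d`-dimensional Brownian motion with respect to the filtration `𝔽`. -/
structure IsBrownian {d : ℕ} {Ω : Type*} {mΩ : MeasurableSpace Ω} (𝔽 : Filtration ℝ≥0 mΩ)
    (P : Measure Ω) (W : ℝ≥0 → Ω → Vec d) : Prop where
  adapted : ∀ t, Measurable[𝔽 t] (W t)
  zero : ∀ᵐ ω ∂P, W 0 ω = 0
  /-- `W_t - W_s` has the law `N(0, (t - s) I_d)`. -/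
  increment_law : ∀ s t : ℝ≥0, s ≤ t →
    P.map (fun ω => W t ω - W s ω) =
      (stdGaussian (Vec d)).map (fun z => Real.sqrt ((t : ℝ) - s) • z)
  /-- `W_t - W_s` is independent of `𝔽_s`. -/
  increment_indep : ∀ s t : ℝ≥0, s ≤ t →
    Indep (MeasurableSpace.comap (fun ω => W t ω - W s ω) inferInstance) (𝔽 s) P
  continuous_paths : ∀ᵐ ω ∂P, Continuous (fun t => W t ω)

/-- The grid point `t_k = k h`, where `h = T / m`. -/
def gridTime (T : ℝ≥0) (m k : ℕ) : ℝ≥0 := k * (T / m)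

/-- The filtration `(𝔽_{t_k})_k`. -/
def gridFiltration {Ω : Type*} {mΩ : MeasurableSpace Ω} (𝔽 : Filtration ℝ≥0 mΩ)
    (T : ℝ≥0) (m : ℕ) : Filtration ℕ mΩ where
  seq k := 𝔽 (gridTime T m k)
  mono' := fun _ _ hkl => 𝔽.mono (mul_le_mul_left (Nat.cast_le.mpr hkl) _)
  le' := fun _ => 𝔽.le _

section Scheme

variable {d q : ℕ} {Ω : Type*}

/-- The noise `ϑ_{k+1} = (W_{t_{k+1}} - W_{t_k}) / √h`. -/
def noise (T : ℝ≥0) (m : ℕ) (W : ℝ≥0 → Ω → Vec d) (k : ℕ) (ω : Ω) : Vec d :=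
  (Real.sqrt ((T : ℝ) / m))⁻¹ • (W (gridTime T m (k + 1)) ω - W (gridTime T m k) ω)

/-- One Euler step `F^h(x, z) = x + b(x) h + σ(x) √h z`. -/
def Model.eulerStep (M : Model d q) (h : ℝ) (x z : Vec d) : Vec d :=
  x + h • M.b x + Real.sqrt h • M.σ x z

/-- The Euler scheme started from `ξ` at time `t_k`: `M.euler T m W k ξ n` is its state at
time `t_{k+n}`. -/
def Model.euler (M : Model d q) (T : ℝ≥0) (m : ℕ) (W : ℝ≥0 → Ω → Vec d) (k : ℕ)
    (ξ : Ω → Vec d) : ℕ → Ω → Vec d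
  | 0, ω => ξ ω
  | n + 1, ω => M.eulerStep ((T : ℝ) / m) (M.euler T m W k ξ n ω) (noise T m W (k + n) ω)

/-- A switching control `(τ_n, ι_n)_{n ≥ 0}` on the time grid: `τ_n = ℓ` stands for a switching
date `t_ℓ`, and `τ_n = ⊤` for a date after `T`. -/
structure Control (Ω : Type*) (q : ℕ) where
  τ : ℕ → Ω → WithTop ℕ
  ι : ℕ → Ω → Fin q

/-- The number `#{n ≥ 1 : τ_n ≤ t_ℓ}` of switches up to time `t_ℓ`. -/
def Control.count (α : Control Ω q) (ℓ : ℕ) (ω : Ω) : ℕ :=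
  Set.ncard {n : ℕ | 1 ≤ n ∧ α.τ n ω ≤ (ℓ : WithTop ℕ)}

/-- The regime at time `t_ℓ`: it is `ι_n` when `τ_n ≤ t_ℓ < τ_{n+1}`. -/
def Control.regime (α : Control Ω q) (ℓ : ℕ) (ω : Ω) : Fin q :=
  α.ι (α.count ℓ ω) ω

/-- The control `α` is admissible for a start in regime `i` at time `t_k`: the `τ_n` are
nondecreasing stopping times with values in `{t_k, …, t_m} ∪ {∞}`, `ι_n` is `𝔽_{τ_n}`-measurable,
`τ_0 = t_k`, `ι_0 = i`, and almost surely some `τ_n` exceeds `T`. Here `𝔾 = (𝔽_{t_k})_k`. -/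
structure Control.Admissible {mΩ : MeasurableSpace Ω} (α : Control Ω q) (𝔾 : Filtration ℕ mΩ)
    (P : Measure Ω) (m k : ℕ) (i : Fin q) : Prop where
  stopping : ∀ n, IsStoppingTime 𝔾 (α.τ n)
  measurable_ι : ∀ n, Measurable[(stopping n).measurableSpace] (α.ι n)
  mono : ∀ ω, Monotone (fun n => α.τ n ω)
  grid : ∀ n ω, α.τ n ω ≤ (m : WithTop ℕ) ∨ α.τ n ω = ⊤
  start_time : ∀ ω, α.τ 0 ω = (k : WithTop ℕ)
  start_regime : ∀ ω, α.ι 0 ω = i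
  finite : ∀ᵐ ω ∂P, ∃ n, (m : WithTop ℕ) < α.τ n ω

/-- The total profit over `[t_k, T]` of the control `α` for the Euler scheme `X̄` started from
`x` at time `t_k`:
`∑_{ℓ=k}^{m-1} f(X̄_{t_ℓ}, I_{t_ℓ}) h + g(X̄_{t_m}, I_{t_m})
  - ∑_{n=1}^{N(α)} c(X̄_{τ_n}, ι_{n-1}, ι_n)`. -/
def Model.profit (M : Model d q) (T : ℝ≥0) (m : ℕ) (W : ℝ≥0 → Ω → Vec d) (k : ℕ) (x : Vec d)
    (α : Control Ω q) (ω : Ω) : ℝ :=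
  let X : ℕ → Vec d := fun ℓ => M.euler T m W k (fun _ => x) (ℓ - k) ω
  (∑ ℓ ∈ Finset.Ico k m, M.f (α.regime ℓ ω) (X ℓ) * ((T : ℝ) / m))
    + M.g (α.regime m ω) (X m)
    - ∑ n ∈ Finset.Icc 1 (α.count m ω),
        M.c (α.ι (n - 1) ω) (α.ι n ω) (X ((α.τ n ω).untopD 0))

/-- The value function `v̄_i(t_k, x)` of the switching problem for the Euler scheme: the supremum
of the expected profit over the admissible controls. Costs are nonnegative and the rewards are
integrable, so the expected profit of any control is a real number or `-∞`; the controls with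
expected profit `-∞` (those with non-integrable profit) do not contribute to the supremum. -/
def Model.value (M : Model d q) (T : ℝ≥0) (m : ℕ) {mΩ : MeasurableSpace Ω}
    (𝔽 : Filtration ℝ≥0 mΩ) (P : Measure Ω) (W : ℝ≥0 → Ω → Vec d) (i : Fin q) (k : ℕ)
    (x : Vec d) : ℝ :=
  sSup {y : ℝ | ∃ α : Control Ω q, α.Admissible (gridFiltration 𝔽 T m) P m k i ∧
    Integrable (M.profit T m W k x α) P ∧ y = ∫ ω, M.profit T m W k x α ω ∂P}

/-- `π` is a (Borel) closest neighbour projection on the finite grid `Γ`. -/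
structure IsNearestProj (Γ : Finset (Vec d)) (π : Vec d → Vec d) : Prop where
  measurable : Measurable π
  mem : ∀ x, π x ∈ Γ
  nearest : ∀ x, ∀ y ∈ Γ, ‖x - π x‖ ≤ ‖x - y‖

/-- The transition weight `ℙ[X̂_{k+1} = y | X̂_k = x]`. -/
def weight {mΩ : MeasurableSpace Ω} (P : Measure Ω) (Xhat : ℕ → Ω → Vec d) (k : ℕ)
    (x y : Vec d) : ℝ :=
  (P[|{ω | Xhat k ω = x}]).real {ω | Xhat (k + 1) ω = y}

/-- The quantization tree algorithm, by the number `n` of remaining steps: at step `m - n`,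
`v̂^i_m = g_i` and `v̂^i_k = max_j [∑_{y ∈ Γ_{k+1}} ℙ[X̂_{k+1} = y | X̂_k = ·] v̂^j_{k+1}(y)
  + h f_j - c_ij]`. -/
def Model.treeAux (M : Model d q) (T : ℝ≥0) (m : ℕ) {mΩ : MeasurableSpace Ω} (P : Measure Ω)
    (Γ : ℕ → Finset (Vec d)) (Xhat : ℕ → Ω → Vec d) : ℕ → Fin q → Vec d → ℝ
  | 0, i, x => M.g i x
  | n + 1, i, x => ⨆ j : Fin q,
      ((∑ y ∈ Γ (m - n), weight P Xhat (m - (n + 1)) x y * M.treeAux T m P Γ Xhat n j y)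
        + ((T : ℝ) / m) * M.f j x - M.c i j x)

/-- The function `v̂^i_k` computed by the quantization tree algorithm. -/
def Model.treeValue (M : Model d q) (T : ℝ≥0) (m : ℕ) {mΩ : MeasurableSpace Ω} (P : Measure Ω)
    (Γ : ℕ → Finset (Vec d)) (Xhat : ℕ → Ω → Vec d) (i : Fin q) (k : ℕ) : Vec d → ℝ :=
  M.treeAux T m P Γ Xhat (m - k) i

end Scheme

end Switching

end

/-! The Euler switching value solves a backward recursion (`value_eq_dp`), and the tree runs the
same recursion with the next state averaged conditionally on the projected state. A finite maximum
is nonexpansive in the sup norm and conditional averaging contracts `L^p`, so the local errors only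
add up (`treeError_succ_le`, `eLpNorm_treeError_le`). Each is of order `(1 + |X̂|) |X̄ - X̂|`, and
Hölder's inequality concludes, provided that the functions of the recursion are locally Lipschitz,
with a constant growing linearly in the state and independent of `h`.

That estimate is the crux (`dp_sub_le_quadratic`, `abs_dp_sub_le`). Since the costs depend on the
state, comparing two points naively adds `L |x - x'|` at every switch, and a switch may occur at
every step, so the constant would blow up like `1/h`. But switches are paid for: along an optimal
strategy the value, made nonnegative by adding `G (1 + |x|)`, rises in mean by at least `δ` at each
switch, up to `O(h)`. A negative quadratic term `-κ (μ U + ν |x - x'|)²` in the comparison function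
turns this rise into a gain `2 κ δ |x - x'|` when `μ ν = 1`. Taking `2 κ δ = L` cancels the
variation of the cost exactly, and only `O(h)` errors remain for Gronwall's argument. Optimizing
over `μ, ν` gives the bound `(1 + |x|) |x - x'|`. -/

noncomputable section

namespace Switching

/-! ### A smooth weight equivalent to `1 + |x|`. -/

section Weight

/-- The weight `√(1 + ‖x‖²)`. -/
def rho {d : ℕ} (x : Vec d) : ℝ := Real.sqrt (1 + ‖x‖ ^ 2)

variable {d : ℕ} (x y : Vec d)

lemma rho_sq : rho x ^ 2 = 1 + ‖x‖ ^ 2 := Real.sq_sqrt (by positivity)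

lemma rho_nonneg : 0 ≤ rho x := Real.sqrt_nonneg _

lemma one_le_rho : 1 ≤ rho x := by
  nlinarith [rho_sq x, rho_nonneg x, sq_nonneg ‖x‖]

lemma norm_le_rho : ‖x‖ ≤ rho x := by
  apply Real.le_sqrt_of_sq_le; linarith

lemma one_add_norm_le : 1 + ‖x‖ ≤ 2 * rho x := by
  linarith [one_le_rho x, norm_le_rho x]

lemma rho_le : rho x ≤ 1 + ‖x‖ := by
  apply Real.sqrt_le_iff.mpr ⟨by positivity, ?_⟩
  nlinarith [norm_nonneg x]

@[fun_prop]
lemma continuous_rho : Continuous (rho (d := d)) := by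
  unfold rho; fun_prop

end Weight

/-! ### Uniform constants for the data. -/

/-- The standing assumptions with common constants. -/
structure Model.Regular {d q : ℕ} (M : Model d q) (L δ : ℝ) : Prop where
  nonneg : 0 ≤ L
  pos : 0 < δ
  lip_b : ∀ x y, ‖M.b x - M.b y‖ ≤ L * ‖x - y‖
  lip_σ : ∀ x y, ‖M.σ x - M.σ y‖ ≤ L * ‖x - y‖
  lip_f : ∀ i x y, |M.f i x - M.f i y| ≤ L * ‖x - y‖
  lip_g : ∀ i x y, |M.g i x - M.g i y| ≤ L * ‖x - y‖
  lip_c : ∀ i j x y, |M.c i j x - M.c i j y| ≤ L * ‖x - y‖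
  growth_b : ∀ x, ‖M.b x‖ ≤ L * rho x
  growth_σ : ∀ x, ‖M.σ x‖ ≤ L * rho x
  growth_f : ∀ i x, |M.f i x| ≤ L * rho x
  growth_g : ∀ i x, |M.g i x| ≤ L * rho x
  growth_c : ∀ i j x, |M.c i j x| ≤ L * rho x
  cost_self : ∀ i x, M.c i i x = 0
  cost_pos : ∀ i j x, j ≠ i → δ ≤ M.c i j x
  triangle : ∀ i j k x, M.c i k x ≤ M.c i j x + M.c j k x
  terminal : ∀ i j x, M.g j x - M.c i j x ≤ M.g i x

/-- A Lipschitz map satisfies, with one constant, a Lipschitz and a linear growth bound. -/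
lemma exists_lip_growth {d : ℕ} {E : Type*} [NormedAddCommGroup E] (F : Vec d → E)
    (h : ∃ L : ℝ≥0, LipschitzWith L F) :
    ∃ L : ℝ, 0 ≤ L ∧ (∀ x y, ‖F x - F y‖ ≤ L * ‖x - y‖) ∧ ∀ x, ‖F x‖ ≤ L * rho x := by
  obtain ⟨K, hK⟩ := h
  have hK' : ∀ x y, ‖F x - F y‖ ≤ K * ‖x - y‖ := fun x y => by
    simpa [dist_eq_norm] using hK.dist_le_mul x y
  refine ⟨K + ‖F 0‖, by positivity, fun x y => (hK' x y).trans ?_, fun x => ?_⟩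
  · gcongr; simp
  · have h1 : ‖F x‖ ≤ ‖F x - F 0‖ + ‖F 0‖ := by
      simpa using norm_add_le (F x - F 0) (F 0)
    have h2 := hK' x 0
    rw [sub_zero] at h2
    have h3 : (K : ℝ) * ‖x‖ ≤ K * rho x := by gcongr; exact norm_le_rho x
    nlinarith [one_le_rho x, norm_nonneg (F 0)]

lemma exists_uniform_lip_growth {d : ℕ} {ι : Type*} [Finite ι] {E : Type*} [NormedAddCommGroup E]
    (F : ι → Vec d → E) (h : ∀ i, ∃ L : ℝ≥0, LipschitzWith L (F i)) :
    ∃ L : ℝ, 0 ≤ L ∧ (∀ i x y, ‖F i x - F i y‖ ≤ L * ‖x - y‖) ∧ ∀ i x, ‖F i x‖ ≤ L * rho x := by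
  choose L hL h1 h2 using fun i => exists_lip_growth (F i) (h i)
  obtain ⟨B, hB⟩ := (Set.finite_range L).bddAbove
  have hB' : ∀ i, L i ≤ max B 0 := fun i => (hB ⟨i, rfl⟩).trans (le_max_left _ _)
  refine ⟨max B 0, le_max_right _ _, fun i x y => (h1 i x y).trans ?_, fun i x => (h2 i x).trans ?_⟩
  · gcongr; exact hB' i
  · gcongr
    · exact rho_nonneg x
    · exact hB' i

lemma Model.Standing.exists_regular {d q : ℕ} {M : Model d q} (hM : M.Standing) :
    ∃ L δ, M.Regular L δ := by
  obtain ⟨Lb, hb0, hb1, hb2⟩ := exists_lip_growth M.b hM.lipschitz_b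
  obtain ⟨Ls, hs0, hs1, hs2⟩ := exists_lip_growth M.σ hM.lipschitz_σ
  obtain ⟨Lf, hf0, hf1, hf2⟩ := exists_uniform_lip_growth M.f hM.lipschitz_f
  obtain ⟨Lg, hg0, hg1, hg2⟩ := exists_uniform_lip_growth M.g hM.lipschitz_g
  obtain ⟨Lc, hc0, hc1, hc2⟩ := exists_uniform_lip_growth
    (fun ij : Fin q × Fin q => M.c ij.1 ij.2) (fun ij => hM.lipschitz_c ij.1 ij.2)
  have hδ : ∃ δ : ℝ, 0 < δ ∧ ∀ i j x, j ≠ i → δ ≤ M.c i j x := by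
    have key : ∀ ij : Fin q × Fin q, ∃ δ : ℝ, 0 < δ ∧ (ij.2 ≠ ij.1 → ∀ x, δ ≤ M.c ij.1 ij.2 x) := by
      intro ij
      by_cases h : ij.2 = ij.1
      · exact ⟨1, one_pos, fun h' => absurd h h'⟩
      · obtain ⟨δ, h1, h2⟩ := hM.cost_pos ij.1 ij.2 h
        exact ⟨δ, h1, fun _ => h2⟩
    choose D hD hD' using key
    by_cases hne : Nonempty (Fin q × Fin q)
    · obtain ⟨a, ha⟩ := Finite.exists_min D
      exact ⟨D a, hD a, fun i j x h => (ha (i, j)).trans (hD' (i, j) h x)⟩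
    · exact ⟨1, one_pos, fun i j => absurd ⟨(i, j)⟩ hne⟩
  obtain ⟨δ, hδ0, hδ⟩ := hδ
  have e1 : Lb ≤ Lb + Ls + Lf + Lg + Lc := by linarith
  have e2 : Ls ≤ Lb + Ls + Lf + Lg + Lc := by linarith
  have e3 : Lf ≤ Lb + Ls + Lf + Lg + Lc := by linarith
  have e4 : Lg ≤ Lb + Ls + Lf + Lg + Lc := by linarith
  have e5 : Lc ≤ Lb + Ls + Lf + Lg + Lc := by linarith
  have cpos : ∀ i j x, 0 ≤ M.c i j x := fun i j x => by
    by_cases h : j = i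
    · rw [h, hM.cost_self]
    · exact hδ0.le.trans (hδ i j x h)
  refine ⟨Lb + Ls + Lf + Lg + Lc, δ,
    { nonneg := by positivity
      pos := hδ0
      lip_b := fun x y => (hb1 x y).trans (by gcongr)
      lip_σ := fun x y => (hs1 x y).trans (by gcongr)
      lip_f := fun i x y => (hf1 i x y).trans (by gcongr)
      lip_g := fun i x y => (hg1 i x y).trans (by gcongr)
      lip_c := fun i j x y => (hc1 (i, j) x y).trans (by gcongr)
      growth_b := fun x => (hb2 x).trans (mul_le_mul_of_nonneg_right e1 (rho_nonneg x))
      growth_σ := fun x => (hs2 x).trans (mul_le_mul_of_nonneg_right e2 (rho_nonneg x))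
      growth_f := fun i x => (hf2 i x).trans (mul_le_mul_of_nonneg_right e3 (rho_nonneg x))
      growth_g := fun i x => (hg2 i x).trans (mul_le_mul_of_nonneg_right e4 (rho_nonneg x))
      growth_c := fun i j x => (hc2 (i, j) x).trans (mul_le_mul_of_nonneg_right e5 (rho_nonneg x))
      cost_self := hM.cost_self
      cost_pos := hδ
      triangle := ?_
      terminal := hM.terminal }⟩
  intro i j k x
  -- The degenerate triangles hold because staying in a regime costs nothing.
  by_cases hji : j = i
  · rw [hji, hM.cost_self]; simp
  by_cases hjk : j = k
  · rw [hjk, hM.cost_self]; simp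
  obtain ⟨ε, h1, h2⟩ := hM.cost_triangle i j k hji hjk
  linarith [h2 x]

/-! ### Moments of affine images of the Gaussian noise. -/

section Gaussian

variable {d : ℕ}

/-- The law `N(0, I_d)` of the noise. -/
abbrev gauss (d : ℕ) : Measure (Vec d) := stdGaussian (Vec d)

/-- The second moment of the noise. -/
def secondMoment (d : ℕ) : ℝ := ∫ z, ‖z‖ ^ 2 ∂(gauss d)

lemma secondMoment_nonneg : 0 ≤ secondMoment d := integral_nonneg fun _ => by positivity

lemma integrable_norm_sq_gauss : Integrable (fun z : Vec d => ‖z‖ ^ 2) (gauss d) :=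
  (IsGaussian.memLp_two_id (μ := gauss d)).integrable_norm_pow (by norm_num)

lemma integrable_affine_gauss (a : Vec d) (s : ℝ) (A : Vec d →L[ℝ] Vec d) :
    Integrable (fun z => a + s • A z) (gauss d) :=
  (integrable_const a).add
    ((A.integrable_comp (IsGaussian.integrable_id (μ := gauss d))).smul s)

lemma integral_affine_gauss (a : Vec d) (s : ℝ) (A : Vec d →L[ℝ] Vec d) :
    ∫ z, (a + s • A z) ∂(gauss d) = a := by
  have h1 := IsGaussian.integrable_id (μ := gauss d)
  have h2 : Integrable (fun z => s • A z) (gauss d) := (A.integrable_comp h1).smul s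
  rw [integral_add (integrable_const a) h2, integral_smul]
  have : ∫ z, A z ∂(gauss d) = 0 := by
    have := A.integral_comp_comm h1
    simp only [id] at this
    rw [this, integral_id_stdGaussian, map_zero]
  simp [this]

lemma integrable_affine_gauss_norm_sq (a : Vec d) (s : ℝ) (A : Vec d →L[ℝ] Vec d) :
    Integrable (fun z => ‖a + s • A z‖ ^ 2) (gauss d) := by
  have : MemLp (fun z => a + s • A z) 2 (gauss d) :=
    (memLp_const a).add ((A.comp_memLp' (IsGaussian.memLp_two_id (μ := gauss d))).const_smul s)
  exact this.integrable_norm_pow (by norm_num)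

/-- Jensen's inequality for the norm: the affine image has mean `a`. -/
lemma norm_le_integral_affine_gauss (a : Vec d) (s : ℝ) (A : Vec d →L[ℝ] Vec d) :
    ‖a‖ ≤ ∫ z, ‖a + s • A z‖ ∂(gauss d) := by
  conv_lhs => rw [← integral_affine_gauss a s A]
  exact norm_integral_le_integral_norm _

/-- The noise is centred, so the cross term integrates to zero and only `s ^ 2` survives. With `s =
√h`, this makes the noise an effect of order `h` rather than `√h`. -/
lemma integral_affine_gauss_norm_sq_le (a : Vec d) (s : ℝ) (A : Vec d →L[ℝ] Vec d) :
    ∫ z, ‖a + s • A z‖ ^ 2 ∂(gauss d) ≤ ‖a‖ ^ 2 + s ^ 2 * ‖A‖ ^ 2 * secondMoment d := by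
  have h1 := IsGaussian.integrable_id (μ := gauss d)
  have hint : Integrable (fun z => inner ℝ a (A z)) (gauss d) :=
    ((innerSL ℝ a).comp A).integrable_comp h1
  have hz : ∫ z, inner ℝ a (A z) ∂(gauss d) = 0 := by
    have := ((innerSL ℝ a).comp A).integral_comp_comm h1
    simp only [id] at this
    rw [integral_id_stdGaussian, map_zero] at this
    simpa using this
  have i1 : Integrable (fun z => 2 * s * inner ℝ a (A z)) (gauss d) := hint.const_mul _
  have i2 : Integrable (fun z : Vec d => s ^ 2 * ‖A‖ ^ 2 * ‖z‖ ^ 2) (gauss d) :=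
    integrable_norm_sq_gauss.const_mul _
  have i3 : Integrable (fun z => ‖a‖ ^ 2 + 2 * s * inner ℝ a (A z)) (gauss d) :=
    (integrable_const _).add i1
  calc ∫ z, ‖a + s • A z‖ ^ 2 ∂(gauss d)
      ≤ ∫ z, (‖a‖ ^ 2 + 2 * s * inner ℝ a (A z) + s ^ 2 * ‖A‖ ^ 2 * ‖z‖ ^ 2) ∂(gauss d) := by
        refine integral_mono (integrable_affine_gauss_norm_sq a s A) (i3.add i2) fun z => ?_
        simp only
        rw [norm_add_sq_real, inner_smul_right, norm_smul, mul_pow, Real.norm_eq_abs, sq_abs]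
        have h : ‖A z‖ ^ 2 ≤ ‖A‖ ^ 2 * ‖z‖ ^ 2 := by
          rw [← mul_pow]; gcongr; exact A.le_opNorm z
        nlinarith [mul_le_mul_of_nonneg_left h (sq_nonneg s)]
    _ = _ := by
        rw [integral_add i3 i2, integral_add (integrable_const _) i1, integral_const_mul,
          integral_const_mul, hz]
        simp [secondMoment]

end Gaussian

/-! ### Moment bounds over one Euler step. -/

section OneStep

variable {d q : ℕ} {M : Model d q} {L δ h : ℝ}

/-- The growth rate of second moments over one Euler step. -/
def momentRate (d : ℕ) (L : ℝ) : ℝ := 2 * L + L ^ 2 + L ^ 2 * secondMoment d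

lemma momentRate_nonneg (hL : 0 ≤ L) : 0 ≤ momentRate d L := by
  have := secondMoment_nonneg (d := d)
  unfold momentRate; positivity

lemma Model.Regular.continuous_b (hM : M.Regular L δ) : Continuous M.b :=
  (LipschitzWith.of_dist_le_mul (K := L.toNNReal) fun x y => by
    simpa [dist_eq_norm, hM.nonneg] using hM.lip_b x y).continuous

lemma Model.Regular.continuous_σ (hM : M.Regular L δ) : Continuous M.σ :=
  (LipschitzWith.of_dist_le_mul (K := L.toNNReal) fun x y => by
    simpa [dist_eq_norm, hM.nonneg] using hM.lip_σ x y).continuous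

lemma Model.Regular.continuous_f (hM : M.Regular L δ) (i) : Continuous (M.f i) :=
  (LipschitzWith.of_dist_le_mul (K := L.toNNReal) fun x y => by
    simpa [dist_eq_norm, hM.nonneg] using hM.lip_f i x y).continuous

lemma Model.Regular.continuous_g (hM : M.Regular L δ) (i) : Continuous (M.g i) :=
  (LipschitzWith.of_dist_le_mul (K := L.toNNReal) fun x y => by
    simpa [dist_eq_norm, hM.nonneg] using hM.lip_g i x y).continuous

lemma Model.Regular.continuous_c (hM : M.Regular L δ) (i j) : Continuous (M.c i j) :=
  (LipschitzWith.of_dist_le_mul (K := L.toNNReal) fun x y => by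
    simpa [dist_eq_norm, hM.nonneg] using hM.lip_c i j x y).continuous

lemma Model.Regular.cost_nonneg (hM : M.Regular L δ) (i j x) : 0 ≤ M.c i j x := by
  by_cases h : j = i
  · rw [h, hM.cost_self]
  · exact hM.pos.le.trans (hM.cost_pos i j x h)

lemma Model.Regular.continuous_eulerStep (hM : M.Regular L δ) (h : ℝ) :
    Continuous (fun p : Vec d × Vec d => M.eulerStep h p.1 p.2) := by
  have h1 := hM.continuous_b
  have h2 := hM.continuous_σ
  unfold Model.eulerStep
  fun_prop

lemma Model.eulerStep_sub (M : Model d q) (h : ℝ) (x y z : Vec d) :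
    M.eulerStep h x z - M.eulerStep h y z =
      (x - y + h • (M.b x - M.b y)) + Real.sqrt h • (M.σ x - M.σ y) z := by
  simp only [Model.eulerStep, sub_apply, smul_sub]
  abel

lemma integrable_norm_sq_eulerStep (M : Model d q) (h : ℝ) (x : Vec d) :
    Integrable (fun z => ‖M.eulerStep h x z‖ ^ 2) (gauss d) :=
  integrable_affine_gauss_norm_sq _ _ _

lemma integrable_rho_sq_eulerStep (M : Model d q) (h : ℝ) (x : Vec d) :
    Integrable (fun z => rho (M.eulerStep h x z) ^ 2) (gauss d) := by
  simp only [rho_sq]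
  exact (integrable_const _).add (integrable_norm_sq_eulerStep M h x)

lemma integrable_norm_eulerStep (M : Model d q) (h : ℝ) (x : Vec d) :
    Integrable (fun z => ‖M.eulerStep h x z‖) (gauss d) :=
  (integrable_affine_gauss _ _ _).norm

lemma integrable_rho_eulerStep (M : Model d q) (h : ℝ) (x : Vec d) :
    Integrable (fun z => rho (M.eulerStep h x z)) (gauss d) := by
  refine ((integrable_const (1 : ℝ)).add (integrable_norm_eulerStep M h x)).mono' ?_ ?_
  · refine (continuous_rho.comp ?_).aestronglyMeasurable
    unfold Model.eulerStep; fun_prop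
  · refine .of_forall fun z => ?_
    rw [Real.norm_of_nonneg (rho_nonneg _)]
    exact rho_le _

lemma integrable_norm_eulerStep_sub (M : Model d q) (h : ℝ) (x y : Vec d) :
    Integrable (fun z => ‖M.eulerStep h x z - M.eulerStep h y z‖) (gauss d) := by
  simp only [Model.eulerStep_sub]
  exact (integrable_affine_gauss _ _ _).norm

lemma integrable_norm_sq_eulerStep_sub (M : Model d q) (h : ℝ) (x y : Vec d) :
    Integrable (fun z => ‖M.eulerStep h x z - M.eulerStep h y z‖ ^ 2) (gauss d) := by
  simp only [Model.eulerStep_sub]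
  exact integrable_affine_gauss_norm_sq _ _ _

lemma integral_rho_sq_eulerStep_le (hM : M.Regular L δ) (h0 : 0 ≤ h) (h1 : h ≤ 1) (x : Vec d) :
    ∫ z, rho (M.eulerStep h x z) ^ 2 ∂(gauss d) ≤ (1 + momentRate d L * h) * rho x ^ 2 := by
  simp only [rho_sq]
  rw [integral_add (integrable_const _) (integrable_norm_sq_eulerStep M h x)]
  have key := integral_affine_gauss_norm_sq_le (x + h • M.b x) (Real.sqrt h) (M.σ x)
  rw [Real.sq_sqrt h0] at key
  have hb := hM.growth_b x
  have hs := hM.growth_σ x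
  have hρ := rho_nonneg x
  have hL := hM.nonneg
  have hm := secondMoment_nonneg (d := d)
  have h2 : ‖x + h • M.b x‖ ≤ ‖x‖ + h * (L * rho x) := by
    refine (norm_add_le _ _).trans ?_
    rw [norm_smul, Real.norm_of_nonneg h0]; gcongr
  have h3 : ‖x + h • M.b x‖ ^ 2 ≤ ‖x‖ ^ 2 + h * ((2 * L + L ^ 2) * rho x ^ 2) := by
    calc ‖x + h • M.b x‖ ^ 2 ≤ (‖x‖ + h * (L * rho x)) ^ 2 := by gcongr
      _ = ‖x‖ ^ 2 + h * (2 * L * (‖x‖ * rho x) + h * (L ^ 2 * rho x ^ 2)) := by ring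
      _ ≤ ‖x‖ ^ 2 + h * (2 * L * (rho x * rho x) + 1 * (L ^ 2 * rho x ^ 2)) := by
        gcongr; exact norm_le_rho x
      _ = _ := by ring
  have h4 : h * ‖M.σ x‖ ^ 2 * secondMoment d ≤ h * (L * rho x) ^ 2 * secondMoment d := by gcongr
  simp only [Model.eulerStep]
  have h5 : ∫ _z : Vec d, (1 : ℝ) ∂(gauss d) = 1 := by simp
  rw [h5, momentRate, ← rho_sq]
  have := rho_sq x
  nlinarith

lemma integral_norm_sq_eulerStep_sub_le (hM : M.Regular L δ) (h0 : 0 ≤ h) (h1 : h ≤ 1)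
    (x y : Vec d) :
    ∫ z, ‖M.eulerStep h x z - M.eulerStep h y z‖ ^ 2 ∂(gauss d) ≤
      (1 + momentRate d L * h) * ‖x - y‖ ^ 2 := by
  simp only [Model.eulerStep_sub]
  have key := integral_affine_gauss_norm_sq_le (x - y + h • (M.b x - M.b y)) (Real.sqrt h)
    (M.σ x - M.σ y)
  rw [Real.sq_sqrt h0] at key
  have hb := hM.lip_b x y
  have hs := hM.lip_σ x y
  have hL := hM.nonneg
  have hm := secondMoment_nonneg (d := d)
  set D := ‖x - y‖ with hD
  have hD0 : 0 ≤ D := norm_nonneg _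
  have h2 : ‖x - y + h • (M.b x - M.b y)‖ ≤ D + h * (L * D) := by
    refine (norm_add_le _ _).trans ?_
    rw [norm_smul, Real.norm_of_nonneg h0]; gcongr
  have h3 : ‖x - y + h • (M.b x - M.b y)‖ ^ 2 ≤ D ^ 2 + h * ((2 * L + L ^ 2) * D ^ 2) := by
    calc _ ≤ (D + h * (L * D)) ^ 2 := by gcongr
      _ = D ^ 2 + h * (2 * L * D ^ 2 + h * (L ^ 2 * D ^ 2)) := by ring
      _ ≤ D ^ 2 + h * (2 * L * D ^ 2 + 1 * (L ^ 2 * D ^ 2)) := by gcongr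
      _ = _ := by ring
  have h4 : h * ‖M.σ x - M.σ y‖ ^ 2 * secondMoment d ≤ h * (L * D) ^ 2 * secondMoment d := by
    gcongr
  rw [momentRate]
  nlinarith

lemma le_integral_norm_eulerStep (hM : M.Regular L δ) (h0 : 0 ≤ h) (x : Vec d) :
    ‖x‖ - h * (L * rho x) ≤ ∫ z, ‖M.eulerStep h x z‖ ∂(gauss d) := by
  refine le_trans ?_ (norm_le_integral_affine_gauss (x + h • M.b x) (Real.sqrt h) (M.σ x))
  have h2 : ‖x‖ ≤ ‖x + h • M.b x‖ + ‖h • M.b x‖ := by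
    simpa using norm_sub_le (x + h • M.b x) (h • M.b x)
  rw [norm_smul, Real.norm_of_nonneg h0] at h2
  nlinarith [mul_le_mul_of_nonneg_left (hM.growth_b x) h0]

lemma le_integral_norm_eulerStep_sub (hM : M.Regular L δ) (h0 : 0 ≤ h) (x y : Vec d) :
    ‖x - y‖ - h * (L * ‖x - y‖) ≤
      ∫ z, ‖M.eulerStep h x z - M.eulerStep h y z‖ ∂(gauss d) := by
  simp only [Model.eulerStep_sub]
  refine le_trans ?_ (norm_le_integral_affine_gauss (x - y + h • (M.b x - M.b y)) (Real.sqrt h)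
    (M.σ x - M.σ y))
  have h2 : ‖x - y‖ ≤ ‖x - y + h • (M.b x - M.b y)‖ + ‖h • (M.b x - M.b y)‖ := by
    simpa using norm_sub_le (x - y + h • (M.b x - M.b y)) (h • (M.b x - M.b y))
  rw [norm_smul, Real.norm_of_nonneg h0] at h2
  nlinarith [mul_le_mul_of_nonneg_left (hM.lip_b x y) h0]

/-- Jensen's inequality for the square. -/
lemma sq_integral_le {X : Type*} [MeasurableSpace X] {ν : Measure X} [IsProbabilityMeasure ν]
    {F : X → ℝ} (hF : Integrable F ν) (hF2 : Integrable (fun z => F z ^ 2) ν) :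
    (∫ z, F z ∂ν) ^ 2 ≤ ∫ z, F z ^ 2 ∂ν := by
  set a := ∫ z, F z ∂ν with ha
  have h1 : ∫ z, (2 * a * F z - a ^ 2) ∂ν ≤ ∫ z, F z ^ 2 ∂ν :=
    integral_mono ((hF.const_mul _).sub (integrable_const _)) hF2
      (fun z => by simp only; nlinarith [sq_nonneg (F z - a)])
  rw [integral_sub (hF.const_mul _) (integrable_const _), integral_const_mul, ← ha] at h1
  simp only [integral_const, probReal_univ, one_smul] at h1
  nlinarith

/-- Follows from the second moment by Jensen, since `1 + C h ≤ (1 + C h)²`. -/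
lemma integral_rho_eulerStep_le (hM : M.Regular L δ) (h0 : 0 ≤ h) (h1 : h ≤ 1) (x : Vec d) :
    ∫ z, rho (M.eulerStep h x z) ∂(gauss d) ≤ (1 + momentRate d L * h) * rho x := by
  have hC := momentRate_nonneg (d := d) hM.nonneg
  have hJ := (sq_integral_le (integrable_rho_eulerStep M h x)
    (integrable_rho_sq_eulerStep M h x)).trans (integral_rho_sq_eulerStep_le hM h0 h1 x)
  have hρ := rho_nonneg x
  have : 0 ≤ momentRate d L * h := by positivity
  refine abs_le_of_sq_le_sq' (hJ.trans ?_) (by positivity) |>.2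
  rw [mul_pow]
  gcongr
  nlinarith

end OneStep

/-! ### The dynamic programming recursion and its linear growth. -/

section DynamicProgramming

variable {d q : ℕ}

/-- The dynamic programming recursion for the Euler scheme with step `h`, by the number of
remaining steps. -/
def Model.dp (M : Model d q) (h : ℝ) : ℕ → Fin q → Vec d → ℝ
  | 0, i, x => M.g i x
  | n + 1, i, x => ⨆ j : Fin q,
      ((∫ z, M.dp h n j (M.eulerStep h x z) ∂(gauss d)) + h * M.f j x - M.c i j x)

/-- The expected value, one step ahead, of being in regime `j` with `n` remaining steps. -/
def Model.cont (M : Model d q) (h : ℝ) (n : ℕ) (j : Fin q) (x : Vec d) : ℝ :=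
  ∫ z, M.dp h n j (M.eulerStep h x z) ∂(gauss d)

lemma Model.dp_succ (M : Model d q) (h : ℝ) (n : ℕ) (i : Fin q) (x : Vec d) :
    M.dp h (n + 1) i x = ⨆ j : Fin q, (M.cont h n j x + h * M.f j x - M.c i j x) := rfl

lemma Model.le_dp_succ (M : Model d q) (h : ℝ) (n : ℕ) (i j : Fin q) (x : Vec d) :
    M.cont h n j x + h * M.f j x - M.c i j x ≤ M.dp h (n + 1) i x := by
  rw [M.dp_succ]
  exact le_ciSup (f := fun j => M.cont h n j x + h * M.f j x - M.c i j x)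
    (Set.finite_range _).bddAbove j

lemma Model.exists_dp_succ_eq (M : Model d q) (h : ℝ) (n : ℕ) (i : Fin q) (x : Vec d) :
    ∃ j, M.cont h n j x + h * M.f j x - M.c i j x = M.dp h (n + 1) i x := by
  have : Nonempty (Fin q) := ⟨i⟩
  rw [M.dp_succ]
  exact exists_eq_ciSup_of_finite

variable {M : Model d q} {L δ h T : ℝ}

lemma Model.Regular.measurable_cont_of_dp (hM : M.Regular L δ) {n : ℕ} {j : Fin q}
    (hn : Measurable (M.dp h n j)) : Measurable (M.cont h n j) := by
  have h1 : Measurable (fun p : Vec d × Vec d => M.dp h n j (M.eulerStep h p.1 p.2)) :=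
    hn.comp (hM.continuous_eulerStep h).measurable
  exact h1.stronglyMeasurable.integral_prod_right.measurable

lemma Model.Regular.measurable_dp (hM : M.Regular L δ) (n : ℕ) (i : Fin q) :
    Measurable (M.dp h n i) := by
  induction n generalizing i with
  | zero => exact (hM.continuous_g i).measurable
  | succ n ih =>
    have : M.dp h (n + 1) i = fun x => ⨆ j : Fin q,
        (M.cont h n j x + h * M.f j x - M.c i j x) := rfl
    rw [this]
    exact Measurable.iSup fun j => ((hM.measurable_cont_of_dp (ih j)).add
      ((hM.continuous_f j).measurable.const_mul h)).sub (hM.continuous_c i j).measurable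

lemma Model.Regular.measurable_cont (hM : M.Regular L δ) (n : ℕ) (j : Fin q) :
    Measurable (M.cont h n j) :=
  hM.measurable_cont_of_dp (hM.measurable_dp n j)

/-- The constant of the linear growth of the value functions. -/
def growthConst (d : ℕ) (L T : ℝ) : ℝ := L * Real.exp ((momentRate d L + 1) * T)

lemma growthConst_nonneg (hL : 0 ≤ L) : 0 ≤ growthConst d L T := by
  unfold growthConst; positivity

lemma one_add_mul_pow_le_exp {B : ℝ} {n : ℕ} (hB : 0 ≤ B) (h0 : 0 ≤ h) (hn : n * h ≤ T) :
    (1 + B * h) ^ n ≤ Real.exp (B * T) := by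
  calc (1 + B * h) ^ n ≤ (Real.exp (B * h)) ^ n := by
        gcongr
        linarith [Real.add_one_le_exp (B * h)]
    _ = Real.exp (B * (n * h)) := by rw [← Real.exp_nat_mul]; ring_nf
    _ ≤ _ := by gcongr

lemma integrable_comp_eulerStep (hM : M.Regular L δ) {F : Vec d → ℝ} (hF : Measurable F) {G : ℝ}
    (hG : ∀ x, |F x| ≤ G * rho x) (h : ℝ) (x : Vec d) :
    Integrable (fun z => F (M.eulerStep h x z)) (gauss d) :=
  ((integrable_rho_eulerStep M h x).const_mul G).mono'
    (hF.comp ((hM.continuous_eulerStep h).comp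
      (Continuous.prodMk_right x)).measurable).aestronglyMeasurable
    (.of_forall fun _ => hG _)

lemma abs_integral_comp_eulerStep_le (hM : M.Regular L δ) (h0 : 0 ≤ h) (h1 : h ≤ 1)
    {F : Vec d → ℝ} {G : ℝ} (hG0 : 0 ≤ G) (hG : ∀ x, |F x| ≤ G * rho x) (x : Vec d) :
    |∫ z, F (M.eulerStep h x z) ∂(gauss d)| ≤ G * ((1 + momentRate d L * h) * rho x) := by
  calc |∫ z, F (M.eulerStep h x z) ∂(gauss d)|
      = ‖∫ z, F (M.eulerStep h x z) ∂(gauss d)‖ := (Real.norm_eq_abs _).symm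
    _ ≤ ∫ z, G * rho (M.eulerStep h x z) ∂(gauss d) :=
        norm_integral_le_of_norm_le ((integrable_rho_eulerStep M h x).const_mul G)
          (.of_forall fun _ => hG _)
    _ = G * ∫ z, rho (M.eulerStep h x z) ∂(gauss d) := integral_const_mul _ _
    _ ≤ _ := by gcongr; exact integral_rho_eulerStep_le hM h0 h1 x

/-- The costs do not enter the bound: from below one stays in the current regime for free, from
above the nonnegative cost is discarded. -/
lemma abs_dp_le_pow (hM : M.Regular L δ) (h0 : 0 ≤ h) (h1 : h ≤ 1) (n : ℕ) (i : Fin q)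
    (x : Vec d) : |M.dp h n i x| ≤ L * (1 + (momentRate d L + 1) * h) ^ n * rho x := by
  have hL := hM.nonneg
  have hC := momentRate_nonneg (d := d) hL
  induction n generalizing i x with
  | zero => simpa [Model.dp] using hM.growth_g i x
  | succ n ih =>
    set p := (1 + (momentRate d L + 1) * h) ^ n with hp
    have hp1 : 1 ≤ p := one_le_pow₀ (by nlinarith)
    have hc : ∀ j, |M.cont h n j x| ≤ L * p * ((1 + momentRate d L * h) * rho x) := fun j =>
      abs_integral_comp_eulerStep_le hM h0 h1 (by positivity) (ih j) x
    have hρ := rho_nonneg x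
    -- The `+ 1` in the rate pays for the running reward, because `p ≥ 1`.
    have hb : L * p * ((1 + momentRate d L * h) * rho x) + h * (L * rho x) ≤
        L * (1 + (momentRate d L + 1) * h) ^ (n + 1) * rho x := by
      rw [pow_succ, ← hp]
      have : h * (L * rho x) * 1 ≤ h * (L * rho x) * p := by gcongr
      nlinarith
    rw [abs_le]
    constructor
    · refine le_trans ?_ (M.le_dp_succ h n i i x)
      rw [hM.cost_self]
      have h2 := (abs_le.1 (hc i)).1
      have h3 := (abs_le.1 (hM.growth_f i x)).1
      nlinarith
    · obtain ⟨j, hj⟩ := M.exists_dp_succ_eq h n i x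
      rw [← hj]
      have h2 := (abs_le.1 (hc j)).2
      have h3 := (abs_le.1 (hM.growth_f j x)).2
      have h4 := hM.cost_nonneg i j x
      nlinarith

lemma abs_dp_le (hM : M.Regular L δ) (h0 : 0 ≤ h) (h1 : h ≤ 1) {n : ℕ} (hn : n * h ≤ T)
    (i : Fin q) (x : Vec d) : |M.dp h n i x| ≤ growthConst d L T * rho x := by
  have hL := hM.nonneg
  have hC := momentRate_nonneg (d := d) hL
  refine (abs_dp_le_pow hM h0 h1 n i x).trans ?_
  unfold growthConst
  gcongr
  · exact rho_nonneg x
  · exact one_add_mul_pow_le_exp (by positivity) h0 hn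

lemma integrable_dp_eulerStep (hM : M.Regular L δ) (h0 : 0 ≤ h) (h1 : h ≤ 1) (n : ℕ) (i : Fin q)
    (x : Vec d) : Integrable (fun z => M.dp h n i (M.eulerStep h x z)) (gauss d) :=
  integrable_comp_eulerStep hM (hM.measurable_dp n i) (abs_dp_le_pow hM h0 h1 n i) h x

end DynamicProgramming

/-! ### Local Lipschitz estimate for the value functions, uniform in the step. -/

section LocalLipschitz

variable {d q : ℕ} {M : Model d q} {L δ h T : ℝ}

/-- The value function, shifted so as to be nonnegative. -/
def Model.shifted (M : Model d q) (h G : ℝ) (n : ℕ) (i : Fin q) (x : Vec d) : ℝ :=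
  M.dp h n i x + G * (1 + ‖x‖)

lemma shifted_nonneg {G : ℝ} (hG0 : 0 ≤ G) {n : ℕ} (hG : ∀ i x, |M.dp h n i x| ≤ G * rho x)
    (i : Fin q) (x : Vec d) : 0 ≤ M.shifted h G n i x := by
  have h1 := (abs_le.1 (hG i x)).1
  have h2 := mul_le_mul_of_nonneg_left (rho_le x) hG0
  unfold Model.shifted
  linarith

lemma shifted_le {G : ℝ} (hG0 : 0 ≤ G) {n : ℕ} (hG : ∀ i x, |M.dp h n i x| ≤ G * rho x)
    (i : Fin q) (x : Vec d) : M.shifted h G n i x ≤ 3 * G * rho x := by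
  have h1 := (abs_le.1 (hG i x)).2
  have h2 := mul_le_mul_of_nonneg_left (one_add_norm_le x) hG0
  unfold Model.shifted
  linarith

/-- The expectation of the shifted value function increases by at least the switching cost, up to
a term of the order of the step. -/
lemma le_integral_shifted (hM : M.Regular L δ) (h0 : 0 ≤ h) (h1 : h ≤ 1) {G : ℝ} (hG0 : 0 ≤ G)
    {n : ℕ} {i j : Fin q} {x : Vec d}
    (hj : M.cont h n j x + h * M.f j x - M.c i j x = M.dp h (n + 1) i x) :
    M.shifted h G (n + 1) i x + M.c i j x - h * ((L + G * L) * rho x) ≤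
      ∫ z, M.shifted h G n j (M.eulerStep h x z) ∂(gauss d) := by
  unfold Model.shifted
  have i1 := integrable_dp_eulerStep hM h0 h1 n j x
  have i2 : Integrable (fun z => 1 + ‖M.eulerStep h x z‖) (gauss d) :=
    (integrable_const _).add (integrable_norm_eulerStep M h x)
  rw [integral_add i1 (i2.const_mul G), integral_const_mul,
    integral_add (integrable_const _) (integrable_norm_eulerStep M h x)]
  have h2 := mul_le_mul_of_nonneg_left (le_integral_norm_eulerStep hM h0 x) hG0
  have h3 := mul_le_mul_of_nonneg_left (abs_le.1 (hM.growth_f j x)).2 h0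
  have h4 : ∫ _z : Vec d, (1 : ℝ) ∂(gauss d) = 1 := by simp
  rw [h4]
  unfold Model.cont at hj
  linarith

lemma integrable_shifted (hM : M.Regular L δ) (h0 : 0 ≤ h) (h1 : h ≤ 1) (G : ℝ) (n : ℕ)
    (j : Fin q) (x : Vec d) :
    Integrable (fun z => M.shifted h G n j (M.eulerStep h x z)) (gauss d) :=
  (integrable_dp_eulerStep hM h0 h1 n j x).add
    (((integrable_const _).add (integrable_norm_eulerStep M h x)).const_mul G)

/-- The quadratic gain on which the local Lipschitz estimate rests: with
`y = μ U + ν D`, `a = μ ρ`, `b = ν D` and a jump `e` of `μ U`. -/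
lemma quadratic_gain {y e a b G L η m₁ h : ℝ} (hG : 0 ≤ G) (hL : 0 ≤ L) (hh : 0 ≤ h)
    (ha : 0 ≤ a) (hb : 0 ≤ b) (hby : b ≤ y) (hy : y ≤ 3 * G * a + b) (he : 0 ≤ e)
    (heL : e ≤ L * a) (hη : η = (L + G * L) * a + L * b) (hm : y + e - h * η ≤ m₁) :
    y ^ 2 + 2 * b * e - 2 * h * (2 * (3 * G + L + 1) * (L + G * L) * (a ^ 2 + b ^ 2)) ≤
      2 * (y + e) * m₁ - (y + e) ^ 2 := by
  have hw : 0 ≤ y + e := by linarith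
  have h1 : 2 * (y + e) * (y + e - h * η) ≤ 2 * (y + e) * m₁ := by gcongr
  have h2 : y ^ 2 + 2 * b * e ≤ (y + e) ^ 2 := by nlinarith [mul_le_mul_of_nonneg_right hby he]
  have h3 : y + e ≤ (3 * G + L + 1) * (a + b) := by nlinarith [mul_nonneg hG hb, mul_nonneg hL hb]
  have hη' : η ≤ (L + G * L) * (a + b) := by
    rw [hη]; nlinarith [mul_nonneg (mul_nonneg hG hL) hb]
  -- The loss caused by the `O(h)` defect `η` of the mean is quadratic in `(a, b)`, hence comparable
  -- with the comparison function itself.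
  have hη0 : 0 ≤ η := by rw [hη]; positivity
  have h4 : (y + e) * η ≤ 2 * (3 * G + L + 1) * (L + G * L) * (a ^ 2 + b ^ 2) := by
    calc (y + e) * η ≤ ((3 * G + L + 1) * (a + b)) * ((L + G * L) * (a + b)) := by gcongr
      _ = (3 * G + L + 1) * (L + G * L) * (a + b) ^ 2 := by ring
      _ ≤ (3 * G + L + 1) * (L + G * L) * (2 * (a ^ 2 + b ^ 2)) := by
        gcongr; nlinarith [sq_nonneg (a - b)]
      _ = _ := by ring
  nlinarith [mul_le_mul_of_nonneg_left h4 hh]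

/-- Weight of the quadratic correction. -/
def kappa (L δ : ℝ) : ℝ := L / (2 * δ)

/-- Rate of the comparison function. -/
def lipRate (d : ℕ) (L δ G : ℝ) : ℝ :=
  momentRate d L + L + 2 * kappa L δ * (2 * (3 * G + L + 1) * (L + G * L))

/-- Initial factor of the comparison function. -/
def lipFactor (L δ G : ℝ) : ℝ := 1 + L + kappa L δ * (18 * G ^ 2 + 2)

/-- Propagates a quadratic comparison through the expectation. The square is bounded below by its
tangent `2 w Y - w ^ 2`, so that only `Y` itself has to be integrated; `w` is free and will be taken
near the expected lower bound of the mean of `Y`. -/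
lemma cont_sub_le_of_forall (hM : M.Regular L δ) (h0 : 0 ≤ h) (h1 : h ≤ 1) {P κ μ ν : ℝ}
    (hP : 0 ≤ P) (hκ : 0 ≤ κ) (w : ℝ) {n : ℕ} {j : Fin q} {x x' : Vec d} {Y : Vec d → ℝ}
    (iY : Integrable Y (gauss d))
    (H : ∀ z, M.dp h n j (M.eulerStep h x z) - M.dp h n j (M.eulerStep h x' z) ≤
      P * (μ ^ 2 * rho (M.eulerStep h x z) ^ 2 +
        ν ^ 2 * ‖M.eulerStep h x z - M.eulerStep h x' z‖ ^ 2) - κ * Y z ^ 2) :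
    M.cont h n j x - M.cont h n j x' ≤
      P * ((1 + momentRate d L * h) * (μ ^ 2 * rho x ^ 2 + ν ^ 2 * ‖x - x'‖ ^ 2)) -
        κ * (2 * w * (∫ z, Y z ∂(gauss d)) - w ^ 2) := by
  have iρ := integrable_rho_sq_eulerStep M h x
  have iD2 := integrable_norm_sq_eulerStep_sub M h x x'
  have iQ : Integrable (fun z => P * (μ ^ 2 * rho (M.eulerStep h x z) ^ 2 +
      ν ^ 2 * ‖M.eulerStep h x z - M.eulerStep h x' z‖ ^ 2)) (gauss d) :=
    ((iρ.const_mul _).add (iD2.const_mul _)).const_mul P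
  have iL : Integrable (fun z => κ * (2 * w * Y z - w ^ 2)) (gauss d) :=
    ((iY.const_mul _).sub (integrable_const _)).const_mul κ
  have iU := integrable_dp_eulerStep hM h0 h1 n j x
  have iU' := integrable_dp_eulerStep hM h0 h1 n j x'
  have e0 : M.cont h n j x - M.cont h n j x' = ∫ z, (M.dp h n j (M.eulerStep h x z) -
      M.dp h n j (M.eulerStep h x' z)) ∂(gauss d) := (integral_sub iU iU').symm
  have e1 : M.cont h n j x - M.cont h n j x' ≤
      ∫ z, (P * (μ ^ 2 * rho (M.eulerStep h x z) ^ 2 +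
        ν ^ 2 * ‖M.eulerStep h x z - M.eulerStep h x' z‖ ^ 2) -
        κ * (2 * w * Y z - w ^ 2)) ∂(gauss d) := by
    rw [e0]
    refine integral_mono (iU.sub iU') (iQ.sub iL) fun z => (H z).trans ?_
    exact sub_le_sub_left (mul_le_mul_of_nonneg_left
      (by linarith [sq_nonneg (Y z - w), sub_sq (Y z) w]) hκ) _
  refine e1.trans ?_
  rw [integral_sub iQ iL, integral_const_mul, integral_const_mul,
    integral_add (iρ.const_mul _) (iD2.const_mul _), integral_const_mul, integral_const_mul,
    integral_sub (iY.const_mul _) (integrable_const _), integral_const_mul]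
  simp only [integral_const, probReal_univ, one_smul]
  have f1 := mul_le_mul_of_nonneg_left (integral_rho_sq_eulerStep_le hM h0 h1 x) (sq_nonneg μ)
  have f2 := mul_le_mul_of_nonneg_left (integral_norm_sq_eulerStep_sub_le hM h0 h1 x x')
    (sq_nonneg ν)
  have f3 := mul_le_mul_of_nonneg_left (add_le_add f1 f2) hP
  linarith

/-- Induction with a penalized comparison function. Set `Q = μ² ρ² + ν² D²`. One step multiplies the
mean of `Q` by at most `1 + momentRate d L * h`; the running reward adds `h L Q`; and a switch adds
at most `L D`, which the growth of the penalized square compensates (`quadratic_gain`) up to `O(h)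
Q`. `lipRate` collects these three rates. In `lipFactor`, the terms `L` and `kappa L δ * (18 * G ^ 2
+ 2)` settle the terminal date, and the `1` keeps the factor of `Q` above one so that additive
errors can be absorbed. -/
lemma dp_sub_le_quadratic (hM : M.Regular L δ) (h0 : 0 ≤ h) (h1 : h ≤ 1) {G : ℝ} (hG0 : 0 ≤ G)
    {N : ℕ} (hG : ∀ n ≤ N, ∀ i x, |M.dp h n i x| ≤ G * rho x) {μ ν : ℝ} (hμ : 0 ≤ μ) (hν : 0 ≤ ν)
    (hμν : μ * ν = 1) (n : ℕ) (hn : n ≤ N) (i : Fin q) (x x' : Vec d) :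
    M.dp h n i x - M.dp h n i x' ≤
      lipFactor L δ G * (1 + lipRate d L δ G * h) ^ n *
          (μ ^ 2 * rho x ^ 2 + ν ^ 2 * ‖x - x'‖ ^ 2) -
        kappa L δ * (μ * M.shifted h G n i x + ν * ‖x - x'‖) ^ 2 := by
  have hL := hM.nonneg
  have hδ := hM.pos
  have hC := momentRate_nonneg (d := d) hL
  have hκ : 0 ≤ kappa L δ := by unfold kappa; positivity
  have hκδ : kappa L δ * (2 * δ) = L := by unfold kappa; field_simp
  have hB : 0 ≤ lipRate d L δ G := by unfold lipRate; positivity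
  have hA : 1 ≤ lipFactor L δ G := by
    unfold lipFactor
    have : 0 ≤ kappa L δ * (18 * G ^ 2 + 2) := by positivity
    linarith
  -- Young's inequality applied to `D = μ * (ν D)`, together with `rho ≥ 1`.
  have hDQ : ∀ x x' : Vec d, ‖x - x'‖ ≤ μ ^ 2 * rho x ^ 2 + ν ^ 2 * ‖x - x'‖ ^ 2 := by
    intro x x'
    have e1 : μ ^ 2 ≤ μ ^ 2 * rho x ^ 2 :=
      le_mul_of_one_le_right (sq_nonneg _) (one_le_pow₀ (one_le_rho x))
    have e2 : ‖x - x'‖ = μ * (ν * ‖x - x'‖) := by rw [← mul_assoc, hμν, one_mul]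
    nlinarith [sq_nonneg (μ - ν * ‖x - x'‖), sq_nonneg μ, sq_nonneg (ν * ‖x - x'‖)]
  induction n generalizing i x x' with
  | zero =>
    set D := ‖x - x'‖ with hD
    have hD0 : 0 ≤ D := norm_nonneg _
    have hρ := rho_nonneg x
    have hg := (abs_le.1 (hM.lip_g i x x')).2
    have hs0 := shifted_nonneg hG0 (hG 0 hn) i x
    have hs1 := shifted_le hG0 (hG 0 hn) i x
    have hy : (μ * M.shifted h G 0 i x + ν * D) ^ 2 ≤
        (18 * G ^ 2 + 2) * (μ ^ 2 * rho x ^ 2 + ν ^ 2 * D ^ 2) := by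
      calc _ ≤ (μ * (3 * G * rho x) + ν * D) ^ 2 := by gcongr
        _ ≤ 2 * (9 * G ^ 2 * (μ ^ 2 * rho x ^ 2)) + 2 * (ν ^ 2 * D ^ 2) := by
          nlinarith [sq_nonneg (μ * (3 * G * rho x) - ν * D)]
        _ ≤ _ := by
          have e1 : 0 ≤ μ ^ 2 * rho x ^ 2 := by positivity
          have e2 : 0 ≤ G ^ 2 * (ν ^ 2 * D ^ 2) := by positivity
          nlinarith
    have hQ := hDQ x x'
    rw [← hD] at hQ
    have hQ0 : 0 ≤ μ ^ 2 * rho x ^ 2 + ν ^ 2 * D ^ 2 := by positivity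
    have hy' := mul_le_mul_of_nonneg_left hy hκ
    have hQ' := mul_le_mul_of_nonneg_left hQ hL
    simp only [Model.dp, pow_zero, mul_one]
    unfold lipFactor
    nlinarith
  | succ n ih =>
    have ih := ih (by omega)
    set D := ‖x - x'‖ with hD
    have hD0 : 0 ≤ D := norm_nonneg _
    have hρ := rho_nonneg x
    -- The regime optimal at `x` is also used at `x'`, where it may be suboptimal. The estimate is
    -- therefore one-sided, with the weight and the shifted value taken at `x`.
    obtain ⟨j, hj⟩ := M.exists_dp_succ_eq h n i x
    have hj' := M.le_dp_succ h n i j x'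
    have hs0 := shifted_nonneg hG0 (hG (n + 1) hn) i x
    have hs1 := shifted_le hG0 (hG (n + 1) hn) i x
    have hint := le_integral_shifted hM h0 h1 hG0 hj
    set P := lipFactor L δ G * (1 + lipRate d L δ G * h) ^ n with hP
    have hP1 : 1 ≤ P := one_le_mul_of_one_le_of_one_le hA
      (one_le_pow₀ (le_add_of_nonneg_right (by positivity)))
    set y := μ * M.shifted h G (n + 1) i x + ν * D with hy
    -- `e` is the guaranteed rise of the shifted value: zero without a switch, `δ` with one. The
    -- choice `κ = L / (2 δ)` makes `2 κ e D` dominate the variation of the cost in both cases.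
    obtain ⟨e, he0, heL, hec, hec'⟩ : ∃ e : ℝ, 0 ≤ e ∧ e ≤ L * rho x ∧ e ≤ M.c i j x ∧
        M.c i j x' - M.c i j x ≤ kappa L δ * (2 * e) * D := by
      by_cases hij : j = i
      · refine ⟨0, le_rfl, by positivity, ?_, ?_⟩ <;> simp [hij, hM.cost_self]
      · refine ⟨δ, hδ.le, (hM.cost_pos i j x hij).trans
          ((le_abs_self _).trans (hM.growth_c i j x)), hM.cost_pos i j x hij, ?_⟩
        rw [hκδ, hD, norm_sub_rev]
        exact (le_abs_self _).trans (hM.lip_c i j x' x)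
    -- Tangent point: the lower bound for the mean of `Y` without its `O(h)` error.
    set w := y + μ * e with hw
    have hw0 : 0 ≤ w := by positivity
    set Y : Vec d → ℝ := fun z => μ * M.shifted h G n j (M.eulerStep h x z) +
      ν * ‖M.eulerStep h x z - M.eulerStep h x' z‖ with hY
    have iS := integrable_shifted hM h0 h1 G n j x
    have iD := integrable_norm_eulerStep_sub M h x x'
    have iY : Integrable Y (gauss d) := (iS.const_mul μ).add (iD.const_mul ν)
    have hm : y + μ * e - h * ((L + G * L) * (μ * rho x) + L * (ν * D)) ≤
        ∫ z, Y z ∂(gauss d) := by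
      rw [hY, integral_add (iS.const_mul μ) (iD.const_mul ν), integral_const_mul,
        integral_const_mul]
      have e1 := mul_le_mul_of_nonneg_left hint hμ
      have e2 := mul_le_mul_of_nonneg_left (le_integral_norm_eulerStep_sub hM h0 x x') hν
      have e3 := mul_le_mul_of_nonneg_left hec hμ
      rw [← hD] at e2
      linarith
    have gain := quadratic_gain (a := μ * rho x) (b := ν * D) hG0 hL h0 (by positivity)
      (by positivity) (by rw [hy]; exact le_add_of_nonneg_left (by positivity))
      (by rw [hy]; nlinarith [mul_le_mul_of_nonneg_left hs1 hμ]) (mul_nonneg hμ he0)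
      (by nlinarith [mul_le_mul_of_nonneg_left heL hμ]) rfl hm
    have hcont := cont_sub_le_of_forall hM h0 h1 (zero_le_one.trans hP1) hκ w iY
      (fun z => ih j (M.eulerStep h x z) (M.eulerStep h x' z))
    rw [← hD] at hcont
    have gain' := mul_le_mul_of_nonneg_left gain hκ
    -- Here `μ ν = 1` makes the gain independent of the weights.
    have hbe : 2 * (ν * D) * (μ * e) = 2 * e * D := by
      linear_combination (2 * e * D) * hμν
    rw [hbe] at gain'
    have hf := mul_le_mul_of_nonneg_left (abs_le.1 (hM.lip_f j x x')).2 h0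
    rw [← hD] at hf
    have hQ := hDQ x x'
    rw [← hD] at hQ
    have hQ' := mul_le_mul_of_nonneg_left hQ (mul_nonneg h0 hL)
    set Q := μ ^ 2 * rho x ^ 2 + ν ^ 2 * D ^ 2 with hQdef
    have hQ0 : 0 ≤ Q := by positivity
    have hab : (μ * rho x) ^ 2 + (ν * D) ^ 2 = Q := by rw [hQdef]; ring
    rw [hab] at gain'
    -- Since `P ≥ 1`, the additive errors of size `h Q` are absorbed into the multiplicative rate.
    have hlast : P * ((1 + momentRate d L * h) * Q) + h * L * Q +
        kappa L δ * (2 * h * (2 * (3 * G + L + 1) * (L + G * L) * Q)) ≤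
        P * (1 + lipRate d L δ G * h) * Q := by
      have e0 : 0 ≤ h * L * Q +
        kappa L δ * (2 * h * (2 * (3 * G + L + 1) * (L + G * L) * Q)) := by positivity
      have e1 := le_mul_of_one_le_left e0 hP1
      unfold lipRate
      linarith
    rw [pow_succ, ← mul_assoc, ← hP]
    linarith

/-- The choice `μ² = b / a`, `ν² = a / b` makes both squares equal to `a * b`. -/
lemma le_of_forall_weights {v K a b : ℝ} (ha : 0 < a) (hb : 0 < b)
    (H : ∀ μ ν : ℝ, 0 ≤ μ → 0 ≤ ν → μ * ν = 1 → v ≤ K * (μ ^ 2 * a ^ 2 + ν ^ 2 * b ^ 2)) :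
    v ≤ 2 * K * (a * b) := by
  have h := H (Real.sqrt (b / a)) (Real.sqrt (a / b)) (Real.sqrt_nonneg _) (Real.sqrt_nonneg _) (by
    rw [← Real.sqrt_mul (by positivity)]
    have : b / a * (a / b) = 1 := by field_simp
    rw [this, Real.sqrt_one])
  rw [Real.sq_sqrt (by positivity), Real.sq_sqrt (by positivity)] at h
  have e : b / a * a ^ 2 + a / b * b ^ 2 = 2 * (a * b) := by field_simp; ring
  rw [e] at h
  linarith

/-- One-sided local Lipschitz constant. -/
def oneSidedLip (d : ℕ) (L δ T : ℝ) : ℝ :=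
  2 * (lipFactor L δ (growthConst d L T) *
    Real.exp (lipRate d L δ (growthConst d L T) * T))

/-- Local Lipschitz constant of the value functions. -/
def valueLip (d : ℕ) (L δ T : ℝ) : ℝ := 3 * oneSidedLip d L δ T + 4 * growthConst d L T

lemma kappa_nonneg (hM : M.Regular L δ) : 0 ≤ kappa L δ := by
  have := hM.nonneg
  have := hM.pos
  unfold kappa; positivity

lemma lipFactor_nonneg (hM : M.Regular L δ) (G : ℝ) : 0 ≤ lipFactor L δ G := by
  have := hM.nonneg
  have := kappa_nonneg hM
  unfold lipFactor; positivity

lemma lipRate_nonneg (hM : M.Regular L δ) {G : ℝ} (hG : 0 ≤ G) : 0 ≤ lipRate d L δ G := by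
  have := hM.nonneg
  have := kappa_nonneg hM
  have := momentRate_nonneg (d := d) hM.nonneg
  unfold lipRate; positivity

lemma oneSidedLip_nonneg (hM : M.Regular L δ) : 0 ≤ oneSidedLip d L δ T := by
  have := lipFactor_nonneg hM (growthConst d L T)
  unfold oneSidedLip; positivity

lemma valueLip_nonneg (hM : M.Regular L δ) : 0 ≤ valueLip d L δ T := by
  have := oneSidedLip_nonneg hM (T := T)
  have := growthConst_nonneg (d := d) (T := T) hM.nonneg
  unfold valueLip; positivity

lemma dp_sub_le (hM : M.Regular L δ) (h0 : 0 ≤ h) (h1 : h ≤ 1) {n : ℕ} (hn : n * h ≤ T)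
    (i : Fin q) (x x' : Vec d) :
    M.dp h n i x - M.dp h n i x' ≤ oneSidedLip d L δ T * (rho x * ‖x - x'‖) := by
  by_cases hx : x = x'
  · simp [hx]
  have hD : 0 < ‖x - x'‖ := norm_pos_iff.2 (sub_ne_zero.2 hx)
  have hG0 := growthConst_nonneg (d := d) (T := T) hM.nonneg
  refine le_of_forall_weights (by linarith [one_le_rho x]) hD fun μ ν hμ hν hμν => ?_
  have key := dp_sub_le_quadratic hM h0 h1 hG0 (N := n)
    (fun k hk => abs_dp_le hM h0 h1 (le_trans (by gcongr) hn)) hμ hν hμν n le_rfl i x x'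
  refine key.trans ((sub_le_self _ (mul_nonneg (kappa_nonneg hM) (sq_nonneg _))).trans ?_)
  have := lipFactor_nonneg hM (growthConst d L T)
  gcongr
  exact one_add_mul_pow_le_exp (lipRate_nonneg hM hG0) h0 hn

lemma rho_le_add (x x' : Vec d) : rho x ≤ 2 * rho x' + ‖x - x'‖ := by
  have h1 : ‖x‖ ≤ ‖x'‖ + ‖x - x'‖ := by simpa using norm_add_le x' (x - x')
  linarith [rho_le x, one_add_norm_le x']

/-- The value functions are locally Lipschitz, with a constant growing linearly in either of the
two points. -/
lemma abs_dp_sub_le (hM : M.Regular L δ) (h0 : 0 ≤ h) (h1 : h ≤ 1) {n : ℕ} (hn : n * h ≤ T)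
    (i : Fin q) (x x' : Vec d) :
    |M.dp h n i x - M.dp h n i x'| ≤ valueLip d L δ T * (rho x' * ‖x - x'‖) := by
  have hK := oneSidedLip_nonneg hM (T := T)
  have hG0 := growthConst_nonneg (d := d) (T := T) hM.nonneg
  have a1 := dp_sub_le hM h0 h1 hn i x x'
  have a2 := dp_sub_le hM h0 h1 hn i x' x
  rw [norm_sub_rev] at a2
  have b1 := abs_le.1 (abs_dp_le hM h0 h1 hn i x)
  have b2 := abs_le.1 (abs_dp_le hM h0 h1 hn i x')
  have hr := rho_le_add x x'
  have hρ' := one_le_rho x'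
  set D := ‖x - x'‖
  have hD0 : 0 ≤ D := norm_nonneg _
  have hρD : 0 ≤ rho x' * D := by positivity
  have e1 : 0 ≤ growthConst d L T * (rho x' * D) := by positivity
  have e2 : 0 ≤ oneSidedLip d L δ T * (rho x' * D) := by positivity
  unfold valueLip
  rw [abs_le]
  constructor
  · linarith
  -- The weight has to move from `x` to `x'`. At distance at most one the two weights are
  -- comparable; farther apart, linear growth of the value alone suffices.
  · by_cases hD1 : D ≤ 1
    · have h3 : rho x * D ≤ 3 * (rho x' * D) := by nlinarith
      have := mul_le_mul_of_nonneg_left h3 hK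
      linarith
    · push Not at hD1
      have h3 : rho x + rho x' ≤ 4 * (rho x' * D) := by nlinarith
      have := mul_le_mul_of_nonneg_left h3 hG0
      linarith

/-- Local Lipschitz constant of the continuation values. -/
def contLip (d : ℕ) (L δ T : ℝ) : ℝ := valueLip d L δ T * (1 + momentRate d L)

lemma contLip_nonneg (hM : M.Regular L δ) : 0 ≤ contLip d L δ T := by
  have := valueLip_nonneg hM (T := T)
  have := momentRate_nonneg (d := d) hM.nonneg
  unfold contLip; positivity

/-- The mean of the product `ρ D` after one step is bounded through its quadratic majorants,
optimized afterwards over the weights; this plays the part of the Cauchy–Schwarz inequality. -/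
lemma abs_cont_sub_le (hM : M.Regular L δ) (h0 : 0 ≤ h) (h1 : h ≤ 1) {n : ℕ} (hn : n * h ≤ T)
    (j : Fin q) (x x' : Vec d) :
    |M.cont h n j x - M.cont h n j x'| ≤ contLip d L δ T * (rho x' * ‖x - x'‖) := by
  by_cases hx : x = x'
  · simp [hx]
  have hD : 0 < ‖x - x'‖ := norm_pos_iff.2 (sub_ne_zero.2 hx)
  have hV := valueLip_nonneg hM (T := T)
  have hC := momentRate_nonneg (d := d) hM.nonneg
  have hc : contLip d L δ T = 2 * (valueLip d L δ T / 2 * (1 + momentRate d L)) := by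
    unfold contLip; ring
  rw [hc]
  refine le_of_forall_weights (by linarith [one_le_rho x']) hD fun μ ν hμ hν hμν => ?_
  have iρ := integrable_rho_sq_eulerStep M h x'
  have iD2 := integrable_norm_sq_eulerStep_sub M h x x'
  have iQ : Integrable (fun z => valueLip d L δ T / 2 * (μ ^ 2 * rho (M.eulerStep h x' z) ^ 2 +
      ν ^ 2 * ‖M.eulerStep h x z - M.eulerStep h x' z‖ ^ 2)) (gauss d) :=
    ((iρ.const_mul _).add (iD2.const_mul _)).const_mul _
  have e0 : M.cont h n j x - M.cont h n j x' = ∫ z, (M.dp h n j (M.eulerStep h x z) -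
      M.dp h n j (M.eulerStep h x' z)) ∂(gauss d) :=
    (integral_sub (integrable_dp_eulerStep hM h0 h1 n j x)
      (integrable_dp_eulerStep hM h0 h1 n j x')).symm
  have e1 : |M.cont h n j x - M.cont h n j x'| ≤
      ∫ z, valueLip d L δ T / 2 * (μ ^ 2 * rho (M.eulerStep h x' z) ^ 2 +
        ν ^ 2 * ‖M.eulerStep h x z - M.eulerStep h x' z‖ ^ 2) ∂(gauss d) := by
    rw [e0, ← Real.norm_eq_abs]
    refine norm_integral_le_of_norm_le iQ (.of_forall fun z => ?_)
    refine (abs_dp_sub_le hM h0 h1 hn j _ _).trans ?_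
    set r := rho (M.eulerStep h x' z)
    set D := ‖M.eulerStep h x z - M.eulerStep h x' z‖
    have : 2 * (r * D) ≤ μ ^ 2 * r ^ 2 + ν ^ 2 * D ^ 2 := by
      have e2 : r * D = (μ * r) * (ν * D) := by linear_combination (-(r * D)) * hμν
      rw [e2]
      nlinarith [sq_nonneg (μ * r - ν * D)]
    nlinarith
  refine e1.trans ?_
  rw [integral_const_mul, integral_add (iρ.const_mul _) (iD2.const_mul _), integral_const_mul,
    integral_const_mul, mul_assoc]
  have f1 := integral_rho_sq_eulerStep_le hM h0 h1 x'
  have f2 := integral_norm_sq_eulerStep_sub_le hM h0 h1 x x'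
  have f3 : 1 + momentRate d L * h ≤ 1 + momentRate d L := by nlinarith
  have f4 := f1.trans (mul_le_mul_of_nonneg_right f3 (sq_nonneg (rho x')))
  have f5 := f2.trans (mul_le_mul_of_nonneg_right f3 (sq_nonneg ‖x - x'‖))
  gcongr
  have f6 := mul_le_mul_of_nonneg_left f4 (sq_nonneg μ)
  have f7 := mul_le_mul_of_nonneg_left f5 (sq_nonneg ν)
  linarith

end LocalLipschitz

/-! ### The Brownian increments as fresh noise, independent of the past. -/

section Noise

variable {d q : ℕ} {Ω : Type*} {mΩ : MeasurableSpace Ω} {𝔽 : Filtration ℝ≥0 mΩ} {P : Measure Ω}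
  {W : ℝ≥0 → Ω → Vec d} {T : ℝ≥0} {m : ℕ}

lemma gridTime_mono {k l : ℕ} (h : k ≤ l) : gridTime T m k ≤ gridTime T m l :=
  mul_le_mul_left (Nat.cast_le.mpr h) _

lemma gridTime_succ_sub (k : ℕ) :
    ((gridTime T m (k + 1) : ℝ≥0) : ℝ) - gridTime T m k = (T : ℝ) / m := by
  simp only [gridTime]; push_cast; ring

lemma IsBrownian.measurable_noise (hW : IsBrownian 𝔽 P W) (k : ℕ) :
    Measurable[gridFiltration 𝔽 T m (k + 1)] (noise T m W k) := by
  have h1 : Measurable[gridFiltration 𝔽 T m (k + 1)] (W (gridTime T m (k + 1))) := hW.adapted _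
  have h2 : Measurable[gridFiltration 𝔽 T m (k + 1)] (W (gridTime T m k)) :=
    (hW.adapted _).mono (𝔽.mono (gridTime_mono (Nat.le_succ k))) le_rfl
  exact (h1.sub h2).const_smul (Real.sqrt ((T : ℝ) / m))⁻¹

lemma IsBrownian.measurable_noise' (hW : IsBrownian 𝔽 P W) (k : ℕ) : Measurable (noise T m W k) :=
  (hW.measurable_noise k).mono ((gridFiltration 𝔽 T m).le _) le_rfl

lemma IsBrownian.map_noise (hW : IsBrownian 𝔽 P W) (hT : 0 < T) (hm : 1 ≤ m) (k : ℕ) :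
    P.map (noise T m W k) = gauss d := by
  have hpos : 0 < Real.sqrt ((T : ℝ) / m) :=
    Real.sqrt_pos.2 (div_pos (by exact_mod_cast hT) (by exact_mod_cast hm))
  have h1 := hW.increment_law _ _ (gridTime_mono (T := T) (m := m) (Nat.le_succ k))
  rw [gridTime_succ_sub] at h1
  have hmeas : Measurable (fun ω => W (gridTime T m (k + 1)) ω - W (gridTime T m k) ω) :=
    ((hW.adapted _).mono (𝔽.le _) le_rfl).sub ((hW.adapted _).mono (𝔽.le _) le_rfl)
  have h2 : noise T m W k = (fun v : Vec d => (Real.sqrt ((T : ℝ) / m))⁻¹ • v) ∘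
      (fun ω => W (gridTime T m (k + 1)) ω - W (gridTime T m k) ω) := rfl
  rw [h2, ← Measure.map_map (measurable_const_smul _) hmeas, h1,
    Measure.map_map (measurable_const_smul _) (measurable_const_smul _)]
  have h3 : ((fun v : Vec d => (Real.sqrt ((T : ℝ) / m))⁻¹ • v) ∘
      fun z => Real.sqrt ((T : ℝ) / m) • z) = id := by
    funext z
    rw [Function.comp_apply, smul_smul, inv_mul_cancel₀ hpos.ne', one_smul, id]
  rw [h3, Measure.map_id]

lemma IsBrownian.indepFun_noise (hW : IsBrownian 𝔽 P W) {S : Type*} [MeasurableSpace S] {k : ℕ}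
    {Z : Ω → S} (hZ : Measurable[gridFiltration 𝔽 T m k] Z) :
    IndepFun Z (noise T m W k) P := by
  have h1 := hW.increment_indep _ _ (gridTime_mono (T := T) (m := m) (Nat.le_succ k))
  rw [IndepFun_iff_Indep]
  refine (indep_of_indep_of_le_left (indep_of_indep_of_le_right h1 ?_) ?_).symm
  · exact hZ.comap_le
  · have h2 : noise T m W k = (fun v : Vec d => (Real.sqrt ((T : ℝ) / m))⁻¹ • v) ∘
      (fun ω => W (gridTime T m (k + 1)) ω - W (gridTime T m k) ω) := rfl
    rw [h2, ← MeasurableSpace.comap_comp]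
    exact MeasurableSpace.comap_mono (measurable_const_smul _).comap_le

/-- Integrating out the noise, which is independent of the past. -/
lemma IsBrownian.integral_comp_noise [IsProbabilityMeasure P] (hW : IsBrownian 𝔽 P W) (hT : 0 < T)
    (hm : 1 ≤ m) {S : Type*} [MeasurableSpace S] {k : ℕ} {Z : Ω → S}
    (hZ : Measurable[gridFiltration 𝔽 T m k] Z) {Ψ : S → Vec d → ℝ}
    (hΨ : Measurable (fun p : S × Vec d => Ψ p.1 p.2))
    (hint : Integrable (fun ω => Ψ (Z ω) (noise T m W k ω)) P) :
    Integrable (fun ω => ∫ z, Ψ (Z ω) z ∂(gauss d)) P ∧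
      ∫ ω, Ψ (Z ω) (noise T m W k ω) ∂P = ∫ ω, ∫ z, Ψ (Z ω) z ∂(gauss d) ∂P := by
  have hZ' : Measurable Z := hZ.mono ((gridFiltration 𝔽 T m).le _) le_rfl
  have hN := hW.measurable_noise' (T := T) (m := m) k
  -- By independence the joint law of the past and the noise is a product, so Fubini's theorem
  -- applies.
  have hmap := (hW.indepFun_noise hZ).map_prod_eq_prod_map_map hZ'.aemeasurable hN.aemeasurable
  rw [hW.map_noise hT hm] at hmap
  have : IsProbabilityMeasure (P.map Z) := Measure.isProbabilityMeasure_map hZ'.aemeasurable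
  have hi : Integrable (fun p : S × Vec d => Ψ p.1 p.2) ((P.map Z).prod (gauss d)) := by
    rw [← hmap]
    exact (integrable_map_measure hΨ.aestronglyMeasurable
      (hZ'.prodMk hN).aemeasurable).2 hint
  constructor
  · exact hi.integral_prod_left.comp_measurable hZ'
  · have h1 : ∫ ω, Ψ (Z ω) (noise T m W k ω) ∂P =
        ∫ p, Ψ p.1 p.2 ∂((P.map Z).prod (gauss d)) := by
      rw [← hmap]
      exact (integral_map (hZ'.prodMk hN).aemeasurable hΨ.aestronglyMeasurable).symm
    rw [h1, integral_prod _ hi]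
    exact integral_map hZ'.aemeasurable
      hΨ.stronglyMeasurable.integral_prod_right.aestronglyMeasurable

variable {M : Model d q} {L δ : ℝ}

lemma measurable_euler (hM : M.Regular L δ) (hW : IsBrownian 𝔽 P W) {k : ℕ} {ξ : Ω → Vec d}
    (hξ : Measurable[gridFiltration 𝔽 T m k] ξ) (n : ℕ) :
    Measurable[gridFiltration 𝔽 T m (k + n)] (M.euler T m W k ξ n) := by
  induction n with
  | zero => exact hξ
  | succ n ih =>
    have h1 : Measurable[gridFiltration 𝔽 T m (k + (n + 1))] (M.euler T m W k ξ n) :=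
      ih.mono ((gridFiltration 𝔽 T m).mono (by omega)) le_rfl
    have h2 : Measurable[gridFiltration 𝔽 T m (k + (n + 1))] (noise T m W (k + n)) :=
      hW.measurable_noise (k + n)
    exact (hM.continuous_eulerStep _).measurable.comp (h1.prodMk h2)

lemma integrable_rho_of_norm {X : Ω → Vec d} [IsProbabilityMeasure P] (hX : Integrable X P) :
    Integrable (fun ω => rho (X ω)) P := by
  refine ((integrable_const (1 : ℝ)).add hX.norm).mono'
    (continuous_rho.comp_aestronglyMeasurable hX.aestronglyMeasurable) (.of_forall fun ω => ?_)
  rw [Real.norm_of_nonneg (rho_nonneg _)]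
  exact rho_le _

lemma integrable_rho_euler_const [IsProbabilityMeasure P] (hM : M.Regular L δ)
    (hW : IsBrownian 𝔽 P W) (hT : 0 < T) (hm : 1 ≤ m) (hh : (T : ℝ) / m ≤ 1) (k : ℕ) (x : Vec d)
    (n : ℕ) : Integrable (fun ω => rho (M.euler T m W k (fun _ => x) n ω)) P := by
  have hmeas : ∀ n, Measurable[gridFiltration 𝔽 T m (k + n)] (M.euler T m W k (fun _ => x) n) :=
    measurable_euler hM hW measurable_const
  have hmeas' : ∀ n, Measurable (M.euler T m W k (fun _ => x) n) := fun n =>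
    (hmeas n).mono ((gridFiltration 𝔽 T m).le _) le_rfl
  induction n with
  | zero => exact integrable_const (rho x)
  | succ n ih =>
    have hh0 : 0 ≤ (T : ℝ) / m := by positivity
    have hN := hW.measurable_noise' (T := T) (m := m) (k + n)
    have iN : Integrable (fun ω => ‖noise T m W (k + n) ω‖) P := by
      have h1 : Integrable (fun z : Vec d => ‖z‖) (P.map (noise T m W (k + n))) := by
        rw [hW.map_noise hT hm]
        exact (IsGaussian.integrable_id (μ := gauss d)).norm
      exact h1.comp_measurable hN
    -- Independence makes the product of two merely integrable variables integrable.
    have hind := (hW.indepFun_noise (hmeas n)).comp continuous_rho.measurable measurable_norm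
    have iprod : Integrable (fun ω => rho (M.euler T m W k (fun _ => x) n ω) *
        ‖noise T m W (k + n) ω‖) P := hind.integrable_mul ih iN
    refine (((ih.const_mul (2 + L)).add (iprod.const_mul L))).mono'
      (continuous_rho.measurable.comp (hmeas' (n + 1))).aestronglyMeasurable
      (.of_forall fun ω => ?_)
    rw [Real.norm_of_nonneg (rho_nonneg _)]
    simp only [Model.euler, Pi.add_apply]
    set y := M.euler T m W k (fun _ => x) n ω
    set z := noise T m W (k + n) ω
    have hL := hM.nonneg
    have e1 : ‖M.eulerStep ((T : ℝ) / m) y z‖ ≤ ‖y‖ + L * rho y + L * rho y * ‖z‖ := by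
      unfold Model.eulerStep
      refine (norm_add₃_le).trans ?_
      have e2 : ‖((T : ℝ) / m) • M.b y‖ ≤ L * rho y := by
        rw [norm_smul, Real.norm_of_nonneg hh0]
        calc _ ≤ 1 * ‖M.b y‖ := by gcongr
          _ ≤ _ := by rw [one_mul]; exact hM.growth_b y
      have e3 : ‖Real.sqrt ((T : ℝ) / m) • M.σ y z‖ ≤ L * rho y * ‖z‖ := by
        rw [norm_smul, Real.norm_of_nonneg (Real.sqrt_nonneg _)]
        calc _ ≤ 1 * ‖M.σ y z‖ := by
              gcongr
              exact Real.sqrt_le_one.2 hh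
          _ ≤ ‖M.σ y‖ * ‖z‖ := by rw [one_mul]; exact (M.σ y).le_opNorm z
          _ ≤ _ := by gcongr; exact hM.growth_σ y
      gcongr
    linarith [rho_le (M.eulerStep ((T : ℝ) / m) y z), one_add_norm_le y]

lemma integrable_of_growth [IsProbabilityMeasure P] {F : Fin q → Vec d → ℝ}
    (hF : ∀ j, Measurable (F j)) {G : ℝ} (hG : ∀ j x, |F j x| ≤ G * rho x) {J : Ω → Fin q}
    (hJ : Measurable J) {X : Ω → Vec d} (hX : Measurable X)
    (hi : Integrable (fun ω => rho (X ω)) P) : Integrable (fun ω => F (J ω) (X ω)) P := by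
  have h1 : Measurable (fun p : Fin q × Vec d => F p.1 p.2) :=
    measurable_from_prod_countable_right hF
  exact (hi.const_mul G).mono' (h1.comp (hJ.prodMk hX)).aestronglyMeasurable
    (.of_forall fun ω => hG _ _)

/-- One step of the dynamic programming principle, in expectation. -/
lemma integral_dp_next [IsProbabilityMeasure P] (hM : M.Regular L δ)
    (hW : IsBrownian 𝔽 P W) (hT : 0 < T) (hm : 1 ≤ m) (hh : (T : ℝ) / m ≤ 1) {k n : ℕ}
    {X : Ω → Vec d} (hX : Measurable[gridFiltration 𝔽 T m k] X)
    {J : Ω → Fin q} (hJ : Measurable[gridFiltration 𝔽 T m k] J)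
    (hi : Integrable (fun ω => rho (M.eulerStep ((T : ℝ) / m) (X ω) (noise T m W k ω))) P) :
    Integrable (fun ω => M.cont ((T : ℝ) / m) n (J ω) (X ω)) P ∧
      ∫ ω, M.dp ((T : ℝ) / m) n (J ω) (M.eulerStep ((T : ℝ) / m) (X ω) (noise T m W k ω)) ∂P =
        ∫ ω, M.cont ((T : ℝ) / m) n (J ω) (X ω) ∂P := by
  have hX' : Measurable X := hX.mono ((gridFiltration 𝔽 T m).le _) le_rfl
  have hJ' : Measurable J := hJ.mono ((gridFiltration 𝔽 T m).le _) le_rfl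
  have hN := hW.measurable_noise' (T := T) (m := m) k
  have hh0 : 0 ≤ (T : ℝ) / m := by positivity
  have h1 : Measurable (fun p : Fin q × Vec d => M.dp ((T : ℝ) / m) n p.1 p.2) :=
    measurable_from_prod_countable_right fun j => hM.measurable_dp n j
  have h2 : Measurable (fun p : (Fin q × Vec d) × Vec d =>
      M.dp ((T : ℝ) / m) n p.1.1 (M.eulerStep ((T : ℝ) / m) p.1.2 p.2)) :=
    h1.comp (measurable_fst.fst.prodMk ((hM.continuous_eulerStep _).measurable.comp
      (measurable_fst.snd.prodMk measurable_snd)))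
  exact hW.integral_comp_noise hT hm (hJ.prodMk hX)
    (Ψ := fun p z => M.dp ((T : ℝ) / m) n p.1 (M.eulerStep ((T : ℝ) / m) p.2 z)) h2
    (integrable_of_growth (hM.measurable_dp n) (abs_dp_le_pow hM hh0 hh n) hJ'
      ((hM.continuous_eulerStep _).measurable.comp (hX'.prodMk hN)) hi)

end Noise

/-! ### Verification argument along the Euler scheme. -/

section Telescoping

variable {d q : ℕ} {Ω : Type*}

/-- The net reward collected at step `l` when the regime changes from `J l` to `J (l + 1)`. -/
def Model.stepReward (M : Model d q) (h : ℝ) (X : ℕ → Ω → Vec d) (J : ℕ → Ω → Fin q) (l : ℕ)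
    (ω : Ω) : ℝ :=
  h * M.f (J (l + 1) ω) (X l ω) - M.c (J l ω) (J (l + 1) ω) (X l ω)

/-- The rewards collected during the first `n` steps, followed by the optimal expected reward. -/
def Model.partialValue (M : Model d q) (h : ℝ) (X : ℕ → Ω → Vec d) (J : ℕ → Ω → Fin q) (N n : ℕ)
    (ω : Ω) : ℝ :=
  (∑ l ∈ Finset.range n, M.stepReward h X J l ω) + M.dp h (N - n) (J n ω) (X n ω)

variable {mΩ : MeasurableSpace Ω} {𝔽 : Filtration ℝ≥0 mΩ} {P : Measure Ω}
  {W : ℝ≥0 → Ω → Vec d} {T : ℝ≥0} {m : ℕ} {M : Model d q} {L δ : ℝ}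

lemma integrable_stepReward [IsProbabilityMeasure P] (hM : M.Regular L δ) (h : ℝ)
    {X : ℕ → Ω → Vec d} {J : ℕ → Ω → Fin q} {l : ℕ} (hX : Measurable (X l)) (hJ : Measurable (J l))
    (hJ' : Measurable (J (l + 1))) (hi : Integrable (fun ω => rho (X l ω)) P) :
    Integrable (M.stepReward h X J l) P := by
  refine ((integrable_of_growth (fun j => (hM.continuous_f j).measurable) hM.growth_f hJ' hX
    hi).const_mul h).sub ?_
  have h1 : Measurable (fun p : (Fin q × Fin q) × Vec d => M.c p.1.1 p.1.2 p.2) :=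
    measurable_from_prod_countable_right fun ij => (hM.continuous_c ij.1 ij.2).measurable
  exact (hi.const_mul L).mono' (h1.comp ((hJ.prodMk hJ').prodMk hX)).aestronglyMeasurable
    (.of_forall fun ω => hM.growth_c _ _ _)

/-- The index is shifted: `J n` is the regime on arrival at `t_{k+n}`, and `J (n + 1)` is the one
chosen there, hence known at that date. The next noise can therefore be integrated out, which turns
`dp` at the next state into `cont` at the present one. -/
lemma integral_partialValue_succ [IsProbabilityMeasure P] (hM : M.Regular L δ)
    (hW : IsBrownian 𝔽 P W) (hT : 0 < T) (hm : 1 ≤ m) (hh : (T : ℝ) / m ≤ 1) {k : ℕ} {x : Vec d}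
    {J : ℕ → Ω → Fin q} {i : Fin q} (hJ0 : ∀ ω, J 0 ω = i) {N : ℕ}
    (hJ : ∀ n < N, Measurable[gridFiltration 𝔽 T m (k + n)] (J (n + 1))) {n : ℕ} (hn : n < N) :
    Integrable (M.partialValue ((T : ℝ) / m) (M.euler T m W k fun _ => x) J N n) P ∧
    Integrable (M.partialValue ((T : ℝ) / m) (M.euler T m W k fun _ => x) J N (n + 1)) P ∧
    Integrable (fun ω => (∑ l ∈ Finset.range (n + 1),
          M.stepReward ((T : ℝ) / m) (M.euler T m W k fun _ => x) J l ω) +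
        M.cont ((T : ℝ) / m) (N - (n + 1)) (J (n + 1) ω)
          (M.euler T m W k (fun _ => x) n ω)) P ∧
    ∫ ω, M.partialValue ((T : ℝ) / m) (M.euler T m W k fun _ => x) J N (n + 1) ω ∂P =
      ∫ ω, ((∑ l ∈ Finset.range (n + 1),
          M.stepReward ((T : ℝ) / m) (M.euler T m W k fun _ => x) J l ω) +
        M.cont ((T : ℝ) / m) (N - (n + 1)) (J (n + 1) ω)
          (M.euler T m W k (fun _ => x) n ω)) ∂P := by
  have hh0 : 0 ≤ (T : ℝ) / m := by positivity
  set X := M.euler T m W k (fun _ => x) with hXdef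
  have hX : ∀ n, Measurable[gridFiltration 𝔽 T m (k + n)] (X n) :=
    measurable_euler hM hW measurable_const
  have hX' : ∀ n, Measurable (X n) := fun n => (hX n).mono ((gridFiltration 𝔽 T m).le _) le_rfl
  have hJ' : ∀ n ≤ N, Measurable (J n) := by
    intro n hn
    cases n with
    | zero => rw [funext hJ0]; exact measurable_const
    | succ n => exact (hJ n hn).mono ((gridFiltration 𝔽 T m).le _) le_rfl
  have hi : ∀ n, Integrable (fun ω => rho (X n ω)) P := integrable_rho_euler_const hM hW hT hm hh k x
  have iR : ∀ l < N, Integrable (M.stepReward ((T : ℝ) / m) X J l) P := fun l hl =>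
    integrable_stepReward hM _ (hX' l) (hJ' l hl.le) (hJ' (l + 1) hl) (hi l)
  have iD : ∀ n ≤ N, ∀ r, Integrable (fun ω => M.dp ((T : ℝ) / m) r (J n ω) (X n ω)) P :=
    fun n hn r => integrable_of_growth (hM.measurable_dp r) (abs_dp_le_pow hM hh0 hh r)
      (hJ' n hn) (hX' n) (hi n)
  have iS : ∀ n ≤ N, Integrable (fun ω => ∑ l ∈ Finset.range n,
      M.stepReward ((T : ℝ) / m) X J l ω) P := fun n hn =>
    integrable_finsetSum _ fun l hl => iR l ((Finset.mem_range.1 hl).trans_le hn)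
  obtain ⟨c1, c2⟩ := integral_dp_next hM hW hT hm hh (n := N - (n + 1)) (hX n) (hJ n hn)
    (hi (n + 1))
  refine ⟨(iS n hn.le).add (iD n hn.le _), (iS _ hn).add (iD _ hn _), (iS _ hn).add c1, ?_⟩
  unfold Model.partialValue
  rw [integral_add (iS _ hn) (iD _ hn _), integral_add (iS _ hn) c1, ← c2]
  rfl

lemma integral_partialValue_zero [IsProbabilityMeasure P] {h : ℝ} {k : ℕ} {x : Vec d}
    {J : ℕ → Ω → Fin q} {i : Fin q} (hJ0 : ∀ ω, J 0 ω = i) (N : ℕ) :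
    ∫ ω, M.partialValue h (M.euler T m W k fun _ => x) J N 0 ω ∂P = M.dp h N i x := by
  simp [Model.partialValue, hJ0, Model.euler]

/-- No adapted sequence of regimes does better than the dynamic programming recursion. -/
lemma integral_partialValue_le [IsProbabilityMeasure P] (hM : M.Regular L δ)
    (hW : IsBrownian 𝔽 P W) (hT : 0 < T) (hm : 1 ≤ m) (hh : (T : ℝ) / m ≤ 1) {k : ℕ} {x : Vec d}
    {J : ℕ → Ω → Fin q} {i : Fin q} (hJ0 : ∀ ω, J 0 ω = i) {N : ℕ}
    (hJ : ∀ n < N, Measurable[gridFiltration 𝔽 T m (k + n)] (J (n + 1))) (n : ℕ) (hn : n ≤ N) :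
    ∫ ω, M.partialValue ((T : ℝ) / m) (M.euler T m W k fun _ => x) J N n ω ∂P ≤
      M.dp ((T : ℝ) / m) N i x := by
  induction n with
  | zero => exact (integral_partialValue_zero hJ0 N).le
  | succ n ih =>
    obtain ⟨i1, i2, i3, e⟩ := integral_partialValue_succ hM hW hT hm hh (x := x) hJ0 hJ
      (Nat.lt_of_succ_le hn)
    refine le_trans ?_ (ih (by omega))
    rw [e]
    have hle : ∀ ω, (∑ l ∈ Finset.range (n + 1),
          M.stepReward ((T : ℝ) / m) (M.euler T m W k fun _ => x) J l ω) +
        M.cont ((T : ℝ) / m) (N - (n + 1)) (J (n + 1) ω) (M.euler T m W k (fun _ => x) n ω) ≤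
        M.partialValue ((T : ℝ) / m) (M.euler T m W k fun _ => x) J N n ω := by
      intro ω
      have h1 := M.le_dp_succ ((T : ℝ) / m) (N - (n + 1)) (J n ω) (J (n + 1) ω)
        (M.euler T m W k (fun _ => x) n ω)
      have h2 : N - (n + 1) + 1 = N - n := by omega
      rw [h2] at h1
      rw [Finset.sum_range_succ]
      unfold Model.partialValue Model.stepReward
      linarith
    exact integral_mono i3 i1 hle

/-- Choosing the maximizing regimes attains the dynamic programming recursion. -/
lemma integral_partialValue_eq [IsProbabilityMeasure P] (hM : M.Regular L δ)
    (hW : IsBrownian 𝔽 P W) (hT : 0 < T) (hm : 1 ≤ m) (hh : (T : ℝ) / m ≤ 1) {k : ℕ} {x : Vec d}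
    {J : ℕ → Ω → Fin q} {i : Fin q} (hJ0 : ∀ ω, J 0 ω = i) {N : ℕ}
    (hJ : ∀ n < N, Measurable[gridFiltration 𝔽 T m (k + n)] (J (n + 1)))
    (hopt : ∀ n < N, ∀ ω, M.cont ((T : ℝ) / m) (N - (n + 1)) (J (n + 1) ω)
          (M.euler T m W k (fun _ => x) n ω) +
        M.stepReward ((T : ℝ) / m) (M.euler T m W k fun _ => x) J n ω =
      M.dp ((T : ℝ) / m) (N - n) (J n ω) (M.euler T m W k (fun _ => x) n ω)) (n : ℕ) (hn : n ≤ N) :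
    ∫ ω, M.partialValue ((T : ℝ) / m) (M.euler T m W k fun _ => x) J N n ω ∂P =
      M.dp ((T : ℝ) / m) N i x := by
  induction n with
  | zero => exact integral_partialValue_zero hJ0 N
  | succ n ih =>
    obtain ⟨-, -, -, e⟩ := integral_partialValue_succ hM hW hT hm hh (x := x) hJ0 hJ
      (Nat.lt_of_succ_le hn)
    rw [e, ← ih (by omega)]
    congr 1
    funext ω
    have h1 := hopt n (Nat.lt_of_succ_le hn) ω
    rw [Finset.sum_range_succ]
    unfold Model.partialValue
    linarith

lemma integrable_partialValue_last [IsProbabilityMeasure P] (hM : M.Regular L δ)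
    (hW : IsBrownian 𝔽 P W) (hT : 0 < T) (hm : 1 ≤ m) (hh : (T : ℝ) / m ≤ 1) {k : ℕ} {x : Vec d}
    {J : ℕ → Ω → Fin q} {i : Fin q} (hJ0 : ∀ ω, J 0 ω = i) {N : ℕ}
    (hJ : ∀ n < N, Measurable[gridFiltration 𝔽 T m (k + n)] (J (n + 1))) :
    Integrable (M.partialValue ((T : ℝ) / m) (M.euler T m W k fun _ => x) J N N) P := by
  cases N with
  | zero =>
    have : M.partialValue ((T : ℝ) / m) (M.euler T m W k fun _ => x) J 0 0 =
        fun _ => M.dp ((T : ℝ) / m) 0 i x := by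
      funext ω
      simp [Model.partialValue, hJ0, Model.euler]
    rw [this]
    exact integrable_const _
  | succ N => exact (integral_partialValue_succ hM hW hT hm hh hJ0 hJ (Nat.lt_succ_self N)).2.1

end Telescoping

/-! ### Counting switches; adaptedness of the regime. -/

section Count

lemma natCast_succ_le_of_lt {a : ℕ} {t : WithTop ℕ} (h : (a : WithTop ℕ) < t) :
    ((a + 1 : ℕ) : WithTop ℕ) ≤ t := by
  induction t using WithTop.recTopCoe with
  | top => exact le_top
  | coe b => exact WithTop.coe_le_coe.2 (WithTop.coe_lt_coe.1 h)

variable {q : ℕ} {Ω : Type*}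

/-- While the control makes finitely many switches, the `n`-th one is made by the date `ℓ` if and
only if `n` is at most the number of switches up to `ℓ`. -/
lemma Control.le_count_iff (α : Control Ω q) {ω : Ω} (hmono : Monotone fun n => α.τ n ω) {ℓ : ℕ}
    (hfin : ∃ n, (ℓ : WithTop ℕ) < α.τ n ω) {n : ℕ} (hn : 1 ≤ n) :
    n ≤ α.count ℓ ω ↔ α.τ n ω ≤ (ℓ : WithTop ℕ) := by
  classical
  set N := Nat.find hfin with hN
  have key : ∀ n, α.τ n ω ≤ (ℓ : WithTop ℕ) ↔ n < N := by
    intro n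
    refine not_iff_not.1 ?_
    rw [not_le, not_lt]
    exact ⟨fun h => Nat.find_min' hfin h, fun h => (Nat.find_spec hfin).trans_le (hmono h)⟩
  have hset : {n : ℕ | 1 ≤ n ∧ α.τ n ω ≤ (ℓ : WithTop ℕ)} = ↑(Finset.Ico 1 N) := by
    ext n
    simp [key]
  rw [Control.count, hset, Set.ncard_coe_finset, Nat.card_Ico, key]
  omega

/-- On paths with infinitely many switches, `Set.ncard` takes its default value `0`. -/
lemma Control.count_eq_zero_of_infinite (α : Control Ω q) {ω : Ω} {ℓ : ℕ}
    (h : ∀ n, α.τ n ω ≤ (ℓ : WithTop ℕ)) : α.count ℓ ω = 0 := by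
  have hset : {n : ℕ | 1 ≤ n ∧ α.τ n ω ≤ (ℓ : WithTop ℕ)} = Set.Ici 1 := by
    ext n
    simp [h]
  rw [Control.count, hset]
  exact (Set.Ici_infinite 1).ncard

/-- For `n ≥ 1` this holds on every path: with infinitely many switches both sides are false. Hence
adaptedness needs no completeness of the filtration. -/
lemma Control.count_eq_iff (α : Control Ω q) {ω : Ω} (hmono : Monotone fun n => α.τ n ω) {ℓ n : ℕ}
    (hn : 1 ≤ n) : α.count ℓ ω = n ↔
      α.τ n ω ≤ (ℓ : WithTop ℕ) ∧ ¬ α.τ (n + 1) ω ≤ (ℓ : WithTop ℕ) := by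
  by_cases hfin : ∃ n, (ℓ : WithTop ℕ) < α.τ n ω
  · rw [← α.le_count_iff hmono hfin hn, ← α.le_count_iff hmono hfin (by omega : 1 ≤ n + 1)]
    omega
  · push Not at hfin
    rw [α.count_eq_zero_of_infinite hfin]
    exact ⟨fun h => by omega, fun h => absurd (hfin _) h.2⟩

variable {mΩ : MeasurableSpace Ω} {P : Measure Ω} {𝔾 : Filtration ℕ mΩ} {α : Control Ω q}
  {m k : ℕ} {i : Fin q}

/-- The current regime is adapted. -/
lemma Control.Admissible.measurable_regime (hα : α.Admissible 𝔾 P m k i) (ℓ : ℕ) :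
    Measurable[𝔾 ℓ] (α.regime ℓ) := by
  have hcount : ∀ n, 1 ≤ n → MeasurableSet[𝔾 ℓ] {ω | α.count ℓ ω = n} := by
    intro n hn
    have : {ω | α.count ℓ ω = n} =
        {ω | α.τ n ω ≤ (ℓ : WithTop ℕ)} \ {ω | α.τ (n + 1) ω ≤ (ℓ : WithTop ℕ)} := by
      ext ω
      exact α.count_eq_iff (hα.mono ω) hn
    rw [this]
    exact (hα.stopping n ℓ).diff (hα.stopping (n + 1) ℓ)
  -- The value `0` mixes paths without switches and paths with infinitely many, so its event is
  -- obtained as a complement.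
  have hcount0 : MeasurableSet[𝔾 ℓ] {ω | α.count ℓ ω = 0} := by
    have : {ω | α.count ℓ ω = 0} = (⋃ n : ℕ, {ω | α.count ℓ ω = n + 1})ᶜ := by
      ext ω
      simp only [Set.mem_ofPred_eq, Set.mem_compl_iff, Set.mem_iUnion, not_exists]
      exact ⟨fun h n => by omega, fun h => by
        by_contra h0
        exact h (α.count ℓ ω - 1) (by omega)⟩
    rw [this]
    exact (MeasurableSet.iUnion fun n => hcount (n + 1) (by omega)).compl
  refine @measurable_to_countable' _ _ _ _ (𝔾 ℓ) _ fun j => ?_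
  -- The redundant event `τ_{n+1} ≤ ℓ` is added because measurability of `ι_{n+1}` at the stopping
  -- time speaks precisely of such intersections.
  have hset : α.regime ℓ ⁻¹' {j} =
      ({ω | α.count ℓ ω = 0} ∩ {_ω | i = j}) ∪
        ⋃ n : ℕ, {ω | α.count ℓ ω = n + 1} ∩
          (α.ι (n + 1) ⁻¹' {j} ∩ {ω | α.τ (n + 1) ω ≤ (ℓ : WithTop ℕ)}) := by
    ext ω
    simp only [Set.mem_preimage, Set.mem_singleton_iff, Control.regime, Set.mem_union,
      Set.mem_inter_iff, Set.mem_ofPred_eq, Set.mem_iUnion]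
    constructor
    · intro h
      by_cases h0 : α.count ℓ ω = 0
      · left
        rw [h0, hα.start_regime] at h
        exact ⟨h0, h⟩
      · right
        obtain ⟨n, hn⟩ := Nat.exists_eq_succ_of_ne_zero h0
        exact ⟨n, hn, by rw [← Nat.succ_eq_add_one, ← hn]; exact h,
          ((α.count_eq_iff (hα.mono ω) (by omega)).1 hn).1⟩
    · rintro (⟨h0, h⟩ | ⟨n, hn, h, -⟩)
      · rw [h0, hα.start_regime]; exact h
      · rw [hn]; exact h
  rw [hset]
  refine (hcount0.inter (@MeasurableSet.const _ (𝔾 ℓ) _)).union (MeasurableSet.iUnion fun n =>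
    (hcount (n + 1) (by omega)).inter ?_)
  have h1 : MeasurableSet[(hα.stopping (n + 1)).measurableSpace] (α.ι (n + 1) ⁻¹' {j}) :=
    hα.measurable_ι (n + 1) (measurableSet_singleton j)
  exact (((hα.stopping (n + 1)).measurableSet _).1 h1).2 ℓ

end Count

/-! ### No admissible control beats the recursion. -/

section UpperBound

variable {d q : ℕ} {M : Model d q} {L δ : ℝ}

/-- Switching at once is not more expensive than switching in several stages at the same place. -/
lemma cost_le_sum_Ioc (hM : M.Regular L δ) (ι : ℕ → Fin q) (y : Vec d) {a b : ℕ} (hab : a ≤ b) :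
    M.c (ι a) (ι b) y ≤ ∑ n ∈ Finset.Ioc a b, M.c (ι (n - 1)) (ι n) y := by
  induction b, hab using Nat.le_induction with
  | base => simp [hM.cost_self]
  | succ b hab ih =>
    rw [Finset.sum_Ioc_succ_top hab]
    have := hM.triangle (ι a) (ι b) (ι (b + 1)) y
    simp only [Nat.add_sub_cancel]
    linarith

lemma sum_cost_le_sum_Ioc (hM : M.Regular L δ) (ι : ℕ → Fin q) (X : ℕ → Vec d) {cnt σ : ℕ → ℕ}
    (hcnt : Monotone cnt) {N : ℕ}
    (hσ : ∀ l < N, ∀ n ∈ Finset.Ioc (cnt l) (cnt (l + 1)), σ n = l) :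
    ∑ l ∈ Finset.range N, M.c (ι (cnt l)) (ι (cnt (l + 1))) (X l) ≤
      ∑ n ∈ Finset.Ioc (cnt 0) (cnt N), M.c (ι (n - 1)) (ι n) (X (σ n)) := by
  induction N with
  | zero => simp
  | succ N ih =>
    rw [Finset.sum_range_succ, ← Finset.sum_Ioc_consecutive _ (hcnt (Nat.zero_le N))
      (hcnt (Nat.le_succ N))]
    refine add_le_add (ih fun l hl => hσ l (by omega)) ?_
    refine (cost_le_sum_Ioc hM ι (X N) (hcnt (Nat.le_succ N))).trans (le_of_eq ?_)
    refine Finset.sum_congr rfl fun n hn => ?_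
    rw [hσ N (by omega) n hn]

variable {Ω : Type*} {mΩ : MeasurableSpace Ω} {𝔽 : Filtration ℝ≥0 mΩ} {P : Measure Ω}
  {W : ℝ≥0 → Ω → Vec d} {T : ℝ≥0} {m k : ℕ} {i : Fin q} {α : Control Ω q} {x : Vec d}

/-- The number of switches before the `l`-th date after `t_k`. -/
def Control.countBefore (α : Control Ω q) (k : ℕ) (ω : Ω) : ℕ → ℕ
  | 0 => 0
  | l + 1 => α.count (k + l) ω

/-- The regime before the `l`-th date after `t_k`. -/
def Control.regimeBefore (α : Control Ω q) (k : ℕ) (l : ℕ) (ω : Ω) : Fin q :=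
  α.ι (α.countBefore k ω l) ω

/-- Several switches at one date are merged into a single one by the triangle inequality, and
switches at the last date are suppressed by the terminal condition. What remains is one decision per
date. -/
lemma profit_le_partialValue {𝔾 : Filtration ℕ mΩ} (hM : M.Regular L δ)
    (hα : α.Admissible 𝔾 P m k i) (hk : k ≤ m) {ω : Ω}
    (hfin : ∃ n, (m : WithTop ℕ) < α.τ n ω) :
    M.profit T m W k x α ω ≤ M.partialValue ((T : ℝ) / m) (M.euler T m W k fun _ => x)
      (α.regimeBefore k) (m - k) (m - k) ω := by
  obtain ⟨N, rfl⟩ := Nat.exists_eq_add_of_le hk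
  have hfin' : ∀ l ≤ N, ∃ n, ((k + l : ℕ) : WithTop ℕ) < α.τ n ω := by
    intro l hl
    obtain ⟨n, hn⟩ := hfin
    exact ⟨n, lt_of_le_of_lt (by exact_mod_cast Nat.add_le_add_left hl k) hn⟩
  have hstep : ∀ l ≤ N, α.countBefore k ω l ≤ α.countBefore k ω (l + 1) := by
    intro l hl
    cases l with
    | zero => exact Nat.zero_le _
    | succ l =>
      simp only [Control.countBefore]
      by_cases h0 : α.count (k + l) ω = 0
      · omega
      rw [α.le_count_iff (hα.mono ω) (hfin' (l + 1) hl) (by omega)]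
      refine ((α.le_count_iff (hα.mono ω) (hfin' l (by omega)) (by omega)).1 le_rfl).trans ?_
      exact_mod_cast (by omega : k + l ≤ k + (l + 1))
  -- Finiteness is known only up to `T`; truncation makes the count monotone on all of `ℕ`.
  set cnt : ℕ → ℕ := fun l => α.countBefore k ω (min l (N + 1)) with hcntdef
  have hcnt : Monotone cnt := by
    refine monotone_nat_of_le_succ fun l => ?_
    simp only [hcntdef]
    by_cases hl : l ≤ N
    · rw [min_eq_left (by omega), min_eq_left (by omega)]
      exact hstep l hl
    · rw [min_eq_right (by omega), min_eq_right (by omega)]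
  have hcnt' : ∀ l ≤ N + 1, cnt l = α.countBefore k ω l := fun l hl => by
    simp only [hcntdef, min_eq_left hl]
  -- A switch counted at `t_{k+l}` but not before takes place exactly there; for `l = 0` the lower
  -- bound comes from `τ_0 = t_k`.
  have hσ : ∀ l < N + 1, ∀ n ∈ Finset.Ioc (cnt l) (cnt (l + 1)),
      (α.τ n ω).untopD 0 - k = l := by
    intro l hl n hn
    rw [Finset.mem_Ioc, hcnt' l (by omega), hcnt' (l + 1) (by omega)] at hn
    have hτ : α.τ n ω = ((k + l : ℕ) : WithTop ℕ) := by
      refine le_antisymm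
        ((α.le_count_iff (hα.mono ω) (hfin' l (by omega)) (by omega)).1 hn.2) ?_
      cases l with
      | zero =>
        have h1 := hα.mono ω (Nat.zero_le n)
        simp only [hα.start_time] at h1
        exact h1
      | succ l =>
        have h1 := hn.1
        simp only [Control.countBefore] at h1
        rw [← not_le, α.le_count_iff (hα.mono ω) (hfin' l (by omega)) (by omega), not_le] at h1
        exact natCast_succ_le_of_lt h1
    rw [hτ]
    exact Nat.add_sub_cancel_left k l
  have hsum := sum_cost_le_sum_Ioc hM (fun n => α.ι n ω)
    (fun l => M.euler T (k + N) W k (fun _ => x) l ω) hcnt hσ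
  have hIoc : Finset.Ioc (cnt 0) (cnt (N + 1)) = Finset.Icc 1 (α.count (k + N) ω) := by
    rw [hcnt' 0 (by omega), hcnt' (N + 1) le_rfl]
    rfl
  rw [hIoc] at hsum
  have hcosts : ∑ l ∈ Finset.range (N + 1), M.c (α.ι (cnt l) ω) (α.ι (cnt (l + 1)) ω)
      (M.euler T (k + N) W k (fun _ => x) l ω) =
      ∑ l ∈ Finset.range (N + 1), M.c (α.regimeBefore k l ω) (α.regimeBefore k (l + 1) ω)
      (M.euler T (k + N) W k (fun _ => x) l ω) := by
    refine Finset.sum_congr rfl fun l hl => ?_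
    have hl' := Finset.mem_range.1 hl
    rw [hcnt' l (by omega), hcnt' (l + 1) (by omega)]
    rfl
  rw [hcosts, Finset.sum_range_succ] at hsum
  -- The sum of costs has `N + 1` terms and the recursion only `N`: the extra one, a switch at `T`,
  -- never improves the terminal gain.
  have hterm := hM.terminal (α.regimeBefore k N ω) (α.regimeBefore k (N + 1) ω)
    (M.euler T (k + N) W k (fun _ => x) N ω)
  have hreg : α.regime (k + N) ω = α.regimeBefore k (N + 1) ω := rfl
  have hsplit : ∑ l ∈ Finset.range N, M.stepReward ((T : ℝ) / (k + N : ℕ))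
      (M.euler T (k + N) W k fun _ => x) (α.regimeBefore k) l ω =
      (∑ l ∈ Finset.range N, M.f (α.regime (k + l) ω) (M.euler T (k + N) W k (fun _ => x) l ω) *
        ((T : ℝ) / (k + N : ℕ))) -
      ∑ l ∈ Finset.range N, M.c (α.regimeBefore k l ω) (α.regimeBefore k (l + 1) ω)
        (M.euler T (k + N) W k (fun _ => x) l ω) := by
    rw [← Finset.sum_sub_distrib]
    refine Finset.sum_congr rfl fun l _ => ?_
    rw [Model.stepReward, mul_comm]
    rfl
  simp only [Model.profit, Model.partialValue, Finset.sum_Ico_eq_sum_range, Nat.add_sub_cancel_left,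
    Nat.sub_self, Model.dp, hsplit, hreg]
  linarith

lemma integral_profit_le [IsProbabilityMeasure P] (hM : M.Regular L δ)
    (hW : IsBrownian 𝔽 P W) (hT : 0 < T) (hm : 1 ≤ m) (hh : (T : ℝ) / m ≤ 1) (hk : k ≤ m)
    (hα : α.Admissible (gridFiltration 𝔽 T m) P m k i) (hint : Integrable (M.profit T m W k x α) P) :
    ∫ ω, M.profit T m W k x α ω ∂P ≤ M.dp ((T : ℝ) / m) (m - k) i x := by
  have hJ0 : ∀ ω, α.regimeBefore k 0 ω = i := hα.start_regime
  have hJ : ∀ n < m - k, Measurable[gridFiltration 𝔽 T m (k + n)] (α.regimeBefore k (n + 1)) :=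
    fun n _ => hα.measurable_regime (k + n)
  refine le_trans (integral_mono_ae hint
    (integrable_partialValue_last hM hW hT hm hh (x := x) hJ0 hJ) ?_)
    (integral_partialValue_le hM hW hT hm hh hJ0 hJ (m - k) le_rfl)
  filter_upwards [hα.finite] with ω hω
  exact profit_le_partialValue hM hα hk hω

end UpperBound

/-! ### An optimal control, and the value as the recursion. -/

section Attainment

variable {d q : ℕ} {M : Model d q} {L δ : ℝ}

/-- A measurable choice of a maximizing regime. -/
lemma exists_measurable_argmax (hM : M.Regular L δ) (h : ℝ) (n : ℕ) (i : Fin q) :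
    ∃ s : Vec d → Fin q, Measurable s ∧ ∀ x,
      M.cont h n (s x) x + h * M.f (s x) x - M.c i (s x) x = M.dp h (n + 1) i x := by
  classical
  set p : ℕ → Vec d → Prop := fun l x => ∃ hl : l < q,
    M.cont h n ⟨l, hl⟩ x + h * M.f ⟨l, hl⟩ x - M.c i ⟨l, hl⟩ x = M.dp h (n + 1) i x with hp
  have hex : ∀ x, ∃ l, p l x := fun x => by
    obtain ⟨j, hj⟩ := M.exists_dp_succ_eq h n i x
    exact ⟨j, j.2, hj⟩
  have hmeas : ∀ l, MeasurableSet {x | p l x} := by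
    intro l
    by_cases hl : l < q
    · have : {x | p l x} = {x | M.cont h n ⟨l, hl⟩ x + h * M.f ⟨l, hl⟩ x - M.c i ⟨l, hl⟩ x =
          M.dp h (n + 1) i x} := by
        ext x
        simp [hp, hl]
      rw [this]
      exact measurableSet_eq_fun (((hM.measurable_cont n _).add
        ((hM.continuous_f _).measurable.const_mul h)).sub (hM.continuous_c i _).measurable)
        (hM.measurable_dp (n + 1) i)
    · have : {x | p l x} = ∅ := by
        ext x
        simp [hp, hl]
      rw [this]
      exact MeasurableSet.empty
  -- The smallest maximizing index is selected; the default `i` is never reached.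
  refine ⟨fun x => if hl : Nat.find (hex x) < q then ⟨Nat.find (hex x), hl⟩ else i, ?_, fun x => ?_⟩
  · exact Measurable.find (f := fun l _ => if hl : l < q then ⟨l, hl⟩ else i)
      (fun _ => measurable_const) hmeas hex
  · obtain ⟨hl, hx⟩ := Nat.find_spec (hex x)
    simp only [hl, dite_true]
    exact hx

variable {Ω : Type*} {mΩ : MeasurableSpace Ω} {𝔽 : Filtration ℝ≥0 mΩ} {P : Measure Ω}
  {W : ℝ≥0 → Ω → Vec d} {T : ℝ≥0} {m k : ℕ}

lemma exists_optimal_regimes (hM : M.Regular L δ) (hW : IsBrownian 𝔽 P W) (k : ℕ) (x : Vec d)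
    (i : Fin q) (N : ℕ) :
    ∃ J : ℕ → Ω → Fin q, (∀ ω, J 0 ω = i) ∧
      (∀ n, Measurable[gridFiltration 𝔽 T m (k + n)] (J (n + 1))) ∧
      ∀ n < N, ∀ ω, M.cont ((T : ℝ) / m) (N - (n + 1)) (J (n + 1) ω)
          (M.euler T m W k (fun _ => x) n ω) +
        M.stepReward ((T : ℝ) / m) (M.euler T m W k fun _ => x) J n ω =
      M.dp ((T : ℝ) / m) (N - n) (J n ω) (M.euler T m W k (fun _ => x) n ω) := by
  choose s hs hopt using exists_measurable_argmax hM ((T : ℝ) / m)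
  have hX : ∀ n, Measurable[gridFiltration 𝔽 T m (k + n)] (M.euler T m W k (fun _ => x) n) :=
    measurable_euler hM hW measurable_const
  -- Feedback: the next regime is the selected maximizer at the current regime and state.
  set J : ℕ → Ω → Fin q := fun n => Nat.rec (fun _ => i)
    (fun l Jl ω => s (N - (l + 1)) (Jl ω) (M.euler T m W k (fun _ => x) l ω)) n with hJ
  have hJs : ∀ l ω, J (l + 1) ω =
    s (N - (l + 1)) (J l ω) (M.euler T m W k (fun _ => x) l ω) := fun l ω => rfl
  refine ⟨J, fun ω => rfl, fun n => ?_, fun n hn ω => ?_⟩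
  · have hstep : ∀ n, Measurable[gridFiltration 𝔽 T m (k + n)] (J n) →
        Measurable[gridFiltration 𝔽 T m (k + n)] (J (n + 1)) := by
      intro n hn
      have h1 : Measurable (fun p : Fin q × Vec d => s (N - (n + 1)) p.1 p.2) :=
        measurable_from_prod_countable_right fun j => hs (N - (n + 1)) j
      exact h1.comp (hn.prodMk (hX n))
    refine hstep n ?_
    induction n with
    | zero => exact measurable_const
    | succ n ih => exact (hstep n ih).mono ((gridFiltration 𝔽 T m).mono (by omega)) le_rfl
  · have h1 := hopt (N - (n + 1)) (J n ω) (M.euler T m W k (fun _ => x) n ω)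
    rw [← hJs, show N - (n + 1) + 1 = N - n by omega] at h1
    rw [← h1, Model.stepReward]
    ring

/-- The control that takes, at each date `t_k, …, t_{k+N-1}`, the regime prescribed by `J`. -/
def Control.ofRegimes (k N : ℕ) (J : ℕ → Ω → Fin q) : Control Ω q where
  τ n _ := if n = 0 then (k : WithTop ℕ) else if n ≤ N then ((k + n - 1 : ℕ) : WithTop ℕ) else ⊤
  ι n := J (min n N)

/-- The dates are deterministic, so being stopping times is immediate. The `n`-th date is
`t_{k+n-1}`, exactly when `J n` becomes known. -/
lemma Control.ofRegimes_admissible {𝔾 : Filtration ℕ mΩ} {J : ℕ → Ω → Fin q} {i : Fin q}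
    (hk : k ≤ m) (hJ0 : ∀ ω, J 0 ω = i) (hJ : ∀ n, Measurable[𝔾 (k + n)] (J (n + 1))) :
    (Control.ofRegimes k (m - k) J).Admissible 𝔾 P m k i := by
  have hτst : ∀ n, IsStoppingTime 𝔾 ((Control.ofRegimes k (m - k) J).τ n) := by
    intro n l
    exact @MeasurableSet.const _ (𝔾 l) ((if n = 0 then (k : WithTop ℕ) else
      if n ≤ m - k then ((k + n - 1 : ℕ) : WithTop ℕ) else ⊤) ≤ WithTop.some l)
  refine
    { stopping := hτst
      measurable_ι := fun n s hs => ?_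
      mono := fun ω a b hab => ?_
      grid := fun n ω => ?_
      start_time := fun ω => rfl
      start_regime := fun ω => by simp [Control.ofRegimes, hJ0]
      finite := .of_forall fun ω => ⟨m - k + 1, by simp [Control.ofRegimes]⟩ }
  · change MeasurableSet[(hτst n).measurableSpace] (J (min n (m - k)) ⁻¹' s)
    rw [IsStoppingTime.measurableSet]
    cases h : min n (m - k) with
    | zero =>
      rw [funext hJ0]
      exact ⟨@MeasurableSet.const _ (⨆ t, 𝔾 t) _, fun l =>
        (@MeasurableSet.const _ (𝔾 l) _).inter (hτst n l)⟩
    | succ r =>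
      refine ⟨le_iSup (fun t => 𝔾 t) (k + r) _ (hJ r hs), fun l => ?_⟩
      by_cases hn : n ≤ m - k
      · have hr : n = r + 1 := by omega
        subst hr
        by_cases hl : k + r ≤ l
        · exact (𝔾.mono hl _ (hJ r hs)).inter (hτst _ l)
        · have : {ω : Ω | (Control.ofRegimes k (m - k) J).τ (r + 1) ω ≤ WithTop.some l} = ∅ := by
            ext ω
            simp only [Control.ofRegimes, Nat.add_eq_zero_iff, one_ne_zero, and_false, if_false, hn,
              if_true, Set.mem_ofPred_eq, Set.mem_empty_iff_false, iff_false]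
            exact fun h => by
              have := Nat.cast_le.1 h
              omega
          rw [this, Set.inter_empty]
          exact @MeasurableSet.empty _ (𝔾 l)
      -- After the last decision the date is `⊤` and the finite-time conditions are void.
      · have : {ω : Ω | (Control.ofRegimes k (m - k) J).τ n ω ≤ WithTop.some l} = ∅ := by
          ext ω
          simp [Control.ofRegimes, hn, show n ≠ 0 by omega]
        rw [this, Set.inter_empty]
        exact @MeasurableSet.empty _ (𝔾 l)
  · simp only [Control.ofRegimes]
    split_ifs <;> first | exact le_top | omega | exact Nat.cast_le.2 (by omega)
  · simp only [Control.ofRegimes]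
    split_ifs
    · exact Or.inl (Nat.cast_le.2 hk)
    · exact Or.inl (Nat.cast_le.2 (by omega))
    · exact Or.inr rfl

lemma Control.count_ofRegimes {N l : ℕ} (J : ℕ → Ω → Fin q) (ω : Ω) :
    (Control.ofRegimes k N J).count (k + l) ω = min N (l + 1) := by
  have hset : {n : ℕ | 1 ≤ n ∧ (Control.ofRegimes k N J).τ n ω ≤ ((k + l : ℕ) : WithTop ℕ)} =
      ↑(Finset.Icc 1 (min N (l + 1))) := by
    ext n
    simp only [Control.ofRegimes, Set.mem_ofPred_eq, Finset.coe_Icc, Set.mem_Icc]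
    refine and_congr_right fun hn => ?_
    rw [if_neg (by omega)]
    split_ifs with h
    · rw [Nat.cast_le]; omega
    · simp only [top_le_iff, WithTop.natCast_ne_top, false_iff, not_le]; omega
  rw [Control.count, hset, Set.ncard_coe_finset, Nat.card_Icc]
  omega

/-- The control formally switches at every date before `T`, possibly to the current regime; such
switches are harmless because `c_ii = 0`. -/
lemma profit_ofRegimes (M : Model d q) (hk : k ≤ m) (x : Vec d) (J : ℕ → Ω → Fin q) (ω : Ω) :
    M.profit T m W k x (Control.ofRegimes k (m - k) J) ω =
      M.partialValue ((T : ℝ) / m) (M.euler T m W k fun _ => x) J (m - k) (m - k) ω := by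
  obtain ⟨N, rfl⟩ := Nat.exists_eq_add_of_le hk
  simp only [Model.profit, Model.partialValue, Finset.sum_Ico_eq_sum_range, Nat.add_sub_cancel_left,
    Nat.sub_self, Model.dp, Control.regime, Control.count_ofRegimes, Model.stepReward,
    Finset.sum_sub_distrib]
  have h1 : ∑ l ∈ Finset.range N, M.f ((Control.ofRegimes k N J).ι (min N (l + 1)) ω)
      (M.euler T (k + N) W k (fun _ => x) l ω) * ((T : ℝ) / (k + N : ℕ)) =
      ∑ l ∈ Finset.range N, (T : ℝ) / (k + N : ℕ) *
        M.f (J (l + 1) ω) (M.euler T (k + N) W k (fun _ => x) l ω) := by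
    refine Finset.sum_congr rfl fun l hl => ?_
    have hl' := Finset.mem_range.1 hl
    rw [mul_comm]
    simp only [Control.ofRegimes]
    rw [show min (min N (l + 1)) N = l + 1 by omega]
  have h2 : ∑ n ∈ Finset.Icc 1 (min N (N + 1)), M.c ((Control.ofRegimes k N J).ι (n - 1) ω)
      ((Control.ofRegimes k N J).ι n ω) (M.euler T (k + N) W k (fun _ => x)
        (((Control.ofRegimes k N J).τ n ω).untopD 0 - k) ω) =
      ∑ l ∈ Finset.range N, M.c (J l ω) (J (l + 1) ω) (M.euler T (k + N) W k (fun _ => x) l ω) := by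
    rw [min_eq_left (Nat.le_succ N), ← Finset.Ico_add_one_right_eq_Icc,
      Finset.sum_Ico_eq_sum_range]
    refine Finset.sum_congr (by simp) fun l hl => ?_
    have hl' : l < N := by simpa using hl
    simp only [Control.ofRegimes, if_neg (show 1 + l ≠ 0 by omega),
      if_pos (show 1 + l ≤ N by omega)]
    rw [show min (1 + l - 1) N = l by omega, show min (1 + l) N = l + 1 by omega,
      show k + (1 + l) - 1 = k + l by omega]
    change M.c _ _ (M.euler T (k + N) W k (fun _ => x) (k + l - k) ω) = _
    rw [Nat.add_sub_cancel_left]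
  rw [h1, h2]
  simp only [Control.ofRegimes]
  rw [show min (min N (N + 1)) N = N by omega]
  ring

/-- The value function of the switching problem for the Euler scheme is given by the dynamic
programming recursion. -/
theorem value_eq_dp [IsProbabilityMeasure P] (hM : M.Regular L δ)
    (hW : IsBrownian 𝔽 P W) (hT : 0 < T) (hm : 1 ≤ m) (hh : (T : ℝ) / m ≤ 1) (hk : k ≤ m)
    (i : Fin q) (x : Vec d) :
    M.value T m 𝔽 P W i k x = M.dp ((T : ℝ) / m) (m - k) i x := by
  refine IsGreatest.csSup_eq ⟨?_, ?_⟩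
  · obtain ⟨J, hJ0, hJ, hopt⟩ := exists_optimal_regimes (T := T) (m := m) hM hW k x i (m - k)
    have hprofit : M.profit T m W k x (Control.ofRegimes k (m - k) J) =
        M.partialValue ((T : ℝ) / m) (M.euler T m W k fun _ => x) J (m - k) (m - k) :=
      funext (profit_ofRegimes M hk x J)
    refine ⟨Control.ofRegimes k (m - k) J, Control.ofRegimes_admissible hk hJ0 hJ, ?_, ?_⟩
    · rw [hprofit]
      exact integrable_partialValue_last hM hW hT hm hh hJ0 fun n _ => hJ n
    · rw [hprofit]
      exact (integral_partialValue_eq hM hW hT hm hh hJ0 (fun n _ => hJ n) hopt (m - k)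
        le_rfl).symm
  · rintro y ⟨α, hα, hint, rfl⟩
    exact integral_profit_le hM hW hT hm hh hk hα hint

end Attainment

/-! ### Conditional averages given a variable with finitely many values. -/

section FiniteRange

variable {d : ℕ} {Ω : Type*} {mΩ : MeasurableSpace Ω} {P : Measure Ω}

/-- The conditional expectation given `Y`, for a variable `Y` with finitely many values. -/
def condAvg (P : Measure Ω) (Y : Ω → Vec d) (Z : Ω → ℝ≥0∞) (ω : Ω) : ℝ≥0∞ :=
  ∫⁻ ω', Z ω' ∂(P[|{ω' | Y ω' = Y ω}])

variable {Y : Ω → Vec d} {Γ : Finset (Vec d)}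

/-- A finite range makes every function of `Y` measurable, so the tree functions need no regularity.
-/
lemma measurable_comp_of_finite {E : Type*} [MeasurableSpace E] (hY : Measurable Y)
    (hΓ : ∀ ω, Y ω ∈ Γ) (F : Vec d → E) : Measurable (fun ω => F (Y ω)) := by
  intro s _
  have : (fun ω => F (Y ω)) ⁻¹' s = Y ⁻¹' (↑Γ ∩ F ⁻¹' s) := by
    ext ω
    simp [hΓ ω]
  rw [this]
  exact hY (Γ.finite_toSet.inter_of_left _).measurableSet

lemma measurableSet_fiber (hY : Measurable Y) (y : Vec d) : MeasurableSet {ω | Y ω = y} :=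
  hY (measurableSet_singleton y)

lemma lintegral_eq_sum_fibers (hY : Measurable Y) (hΓ : ∀ ω, Y ω ∈ Γ) (F : Ω → ℝ≥0∞) :
    ∫⁻ ω, F ω ∂P = ∑ y ∈ Γ, ∫⁻ ω in {ω | Y ω = y}, F ω ∂P := by
  rw [← lintegral_biUnion_finset (fun a _ b _ hab => ?_) (fun y _ => measurableSet_fiber hY y)]
  · have : ⋃ y ∈ Γ, {ω | Y ω = y} = Set.univ := by
      ext ω
      simp [hΓ ω]
    rw [this, Measure.restrict_univ]
  · refine Set.disjoint_left.2 fun ω h1 h2 => hab ?_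
    exact (show Y ω = a from h1).symm.trans h2

/-- Jensen's inequality, read off from the monotonicity of `L^p` norms under a probability measure.
-/
lemma lintegral_rpow_le [IsProbabilityMeasure P] {Z : Ω → ℝ≥0∞} (hZ : Measurable Z) {p : ℝ}
    (hp : 1 ≤ p) : (∫⁻ ω, Z ω ∂P) ^ p ≤ ∫⁻ ω, Z ω ^ p ∂P := by
  have hp0 : 0 < p := by linarith
  have h := eLpNorm_le_eLpNorm_of_exponent_le (μ := P) (f := Z)
    (ENNReal.one_le_ofReal.2 hp) hZ.aestronglyMeasurable
  rw [eLpNorm_one_eq_lintegral_enorm, eLpNorm_eq_lintegral_rpow_enorm_toReal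
    (by simpa using hp0) ENNReal.ofReal_ne_top, ENNReal.toReal_ofReal hp0.le] at h
  simp only [enorm_eq_self, one_div] at h
  exact (ENNReal.le_rpow_inv_iff hp0).1 h

/-- Jensen's inequality on each fibre of positive probability; null fibres contribute nothing. -/
lemma eLpNorm_condAvg_le [IsProbabilityMeasure P] (hY : Measurable Y) (hΓ : ∀ ω, Y ω ∈ Γ)
    {Z : Ω → ℝ≥0∞} (hZ : Measurable Z) {p : ℝ} (hp : 1 ≤ p) :
    eLpNorm (condAvg P Y Z) (ENNReal.ofReal p) P ≤ eLpNorm Z (ENNReal.ofReal p) P := by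
  have hp0 : 0 < p := by linarith
  rw [eLpNorm_eq_lintegral_rpow_enorm_toReal (by simpa using hp0) ENNReal.ofReal_ne_top,
    eLpNorm_eq_lintegral_rpow_enorm_toReal (by simpa using hp0) ENNReal.ofReal_ne_top,
    ENNReal.toReal_ofReal hp0.le]
  simp only [enorm_eq_self]
  refine ENNReal.rpow_le_rpow ?_ (by positivity)
  rw [lintegral_eq_sum_fibers hY hΓ, lintegral_eq_sum_fibers hY hΓ (fun ω => Z ω ^ p)]
  refine Finset.sum_le_sum fun y _ => ?_
  have hA := measurableSet_fiber hY y
  set A := {ω | Y ω = y} with hAdef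
  have hconst : ∫⁻ ω in A, condAvg P Y Z ω ^ p ∂P = (∫⁻ ω', Z ω' ∂(P[|A])) ^ p * P A := by
    rw [← setLIntegral_const]
    refine setLIntegral_congr_fun hA fun ω hω => ?_
    have : Y ω = y := hω
    simp only [condAvg, this, hAdef]
  rw [hconst]
  by_cases hPA : P A = 0
  · rw [hPA, mul_zero]; exact zero_le
  have : IsProbabilityMeasure (P[|A]) := cond_isProbabilityMeasure hPA
  calc (∫⁻ ω', Z ω' ∂(P[|A])) ^ p * P A ≤ (∫⁻ ω', Z ω' ^ p ∂(P[|A])) * P A := by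
        gcongr; exact lintegral_rpow_le hZ hp
    _ = ∫⁻ ω in A, Z ω ^ p ∂P := by
        rw [ProbabilityTheory.cond, lintegral_smul_measure, smul_eq_mul, mul_right_comm,
          ENNReal.inv_mul_cancel hPA (measure_ne_top P A), one_mul]

lemma ae_measure_fiber_ne_zero (hΓ : ∀ ω, Y ω ∈ Γ) :
    ∀ᵐ ω ∂P, P {ω' | Y ω' = Y ω} ≠ 0 := by
  have : {ω | ¬ P {ω' | Y ω' = Y ω} ≠ 0} ⊆
      ⋃ y ∈ Γ.filter (fun y => P {ω' | Y ω' = y} = 0), {ω' | Y ω' = y} := by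
    intro ω hω
    have hω' : P {ω' | Y ω' = Y ω} = 0 := not_not.1 hω
    simp [hΓ ω, hω']
  refine measure_mono_null this ((measure_biUnion_null_iff (Finset.countable_toSet _)).2 ?_)
  intro y hy
  exact (Finset.mem_filter.1 hy).2

lemma integrable_comp_of_finite [IsFiniteMeasure P] (hY : Measurable Y) (hΓ : ∀ ω, Y ω ∈ Γ)
    {E : Type*} [NormedAddCommGroup E] [MeasurableSpace E] [BorelSpace E]
    [SecondCountableTopology E] (F : Vec d → E) :
    Integrable (fun ω => F (Y ω)) P := by
  obtain ⟨C, hC⟩ := (Γ.finite_toSet.image fun y => ‖F y‖).bddAbove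
  exact Integrable.of_bound (measurable_comp_of_finite hY hΓ F).aestronglyMeasurable C
    (.of_forall fun ω => hC ⟨Y ω, hΓ ω, rfl⟩)

lemma integral_comp_eq_sum [IsFiniteMeasure P] (hY : Measurable Y) (hΓ : ∀ ω, Y ω ∈ Γ)
    (F : Vec d → ℝ) : ∫ ω, F (Y ω) ∂P = ∑ y ∈ Γ, P.real {ω | Y ω = y} * F y := by
  have h1 : ∀ ω, F (Y ω) = ∑ y ∈ Γ, {ω | Y ω = y}.indicator (fun _ => F y) ω := by
    intro ω
    rw [Finset.sum_eq_single (Y ω)]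
    · simp
    · intro y _ hy
      exact Set.indicator_of_notMem (fun h => hy h.symm) _
    · exact fun h => absurd (hΓ ω) h
  simp_rw [h1]
  rw [integral_finsetSum]
  · refine Finset.sum_congr rfl fun y _ => ?_
    rw [integral_indicator_const _ (measurableSet_fiber hY y), smul_eq_mul]
  · intro y _
    exact (integrable_const _).indicator (measurableSet_fiber hY y)

lemma integrable_cond {E : Type*} [NormedAddCommGroup E] {F : Ω → E} (hF : Integrable F P)
    {A : Set Ω} (hA : P A ≠ 0) : Integrable F (P[|A]) :=
  hF.restrict.smul_measure (ENNReal.inv_ne_top.2 hA)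

lemma enorm_iSup_sub_iSup_le {q : ℕ} [Nonempty (Fin q)] (a b : Fin q → ℝ) {c : ℝ≥0∞}
    (h : ∀ j, ‖a j - b j‖ₑ ≤ c) : ‖(⨆ j, a j) - ⨆ j, b j‖ₑ ≤ c := by
  obtain ⟨j, hj⟩ := exists_eq_ciSup_of_finite (f := a)
  obtain ⟨l, hl⟩ := exists_eq_ciSup_of_finite (f := b)
  have h1 : a l ≤ ⨆ j, a j := le_ciSup (Set.finite_range a).bddAbove l
  have h2 : b j ≤ ⨆ j, b j := le_ciSup (Set.finite_range b).bddAbove j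
  simp only [Real.enorm_eq_ofReal_abs] at h ⊢
  rcases abs_cases ((⨆ j, a j) - ⨆ j, b j) with ⟨e, -⟩ | ⟨e, -⟩
  · refine le_trans (ENNReal.ofReal_le_ofReal ?_) (h j)
    rw [e]
    refine le_trans ?_ (le_abs_self _)
    linarith
  · refine le_trans (ENNReal.ofReal_le_ofReal ?_) (h l)
    rw [e]
    refine le_trans ?_ (neg_le_abs _)
    linarith

end FiniteRange

/-! ### Propagation of the quantization error. -/

section Quantization

variable {d q : ℕ} {M : Model d q} {L δ : ℝ} {Ω : Type*} {mΩ : MeasurableSpace Ω}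
  {𝔽 : Filtration ℝ≥0 mΩ} {P : Measure Ω} {W : ℝ≥0 → Ω → Vec d} {T : ℝ≥0} {m : ℕ}

/-- The conditioning event belongs to the past, so its indicator can be carried along while the
noise is integrated out. It is applied to the fibres of the projected state. -/
lemma integral_cond_dp_next [IsProbabilityMeasure P] (hM : M.Regular L δ)
    (hW : IsBrownian 𝔽 P W) (hT : 0 < T) (hm : 1 ≤ m) (hh : (T : ℝ) / m ≤ 1) {k n : ℕ} {j : Fin q}
    {X : Ω → Vec d} (hX : Measurable[gridFiltration 𝔽 T m k] X)
    (hi : Integrable (fun ω => rho (M.eulerStep ((T : ℝ) / m) (X ω) (noise T m W k ω))) P)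
    {B : Set (Vec d)} (hB : MeasurableSet B) :
    ∫ ω, M.dp ((T : ℝ) / m) n j (M.eulerStep ((T : ℝ) / m) (X ω) (noise T m W k ω))
        ∂(P[|X ⁻¹' B]) = ∫ ω, M.cont ((T : ℝ) / m) n j (X ω) ∂(P[|X ⁻¹' B]) := by
  have hX' : Measurable X := hX.mono ((gridFiltration 𝔽 T m).le _) le_rfl
  have hN := hW.measurable_noise' (T := T) (m := m) k
  have hh0 : 0 ≤ (T : ℝ) / m := by positivity
  have h2 : Measurable (fun p : Vec d × Vec d =>
      M.dp ((T : ℝ) / m) n j (M.eulerStep ((T : ℝ) / m) p.1 p.2)) :=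
    (hM.measurable_dp n j).comp (hM.continuous_eulerStep _).measurable
  have hΨ : Measurable (fun p : Vec d × Vec d =>
      B.indicator (fun y => M.dp ((T : ℝ) / m) n j (M.eulerStep ((T : ℝ) / m) y p.2)) p.1) :=
    h2.indicator (measurable_fst hB)
  have hint : Integrable (fun ω =>
      M.dp ((T : ℝ) / m) n j (M.eulerStep ((T : ℝ) / m) (X ω) (noise T m W k ω))) P :=
    (hi.const_mul _).mono' (h2.comp (hX'.prodMk hN)).aestronglyMeasurable
      (.of_forall fun ω => abs_dp_le_pow hM hh0 hh n j _)
  have key := (hW.integral_comp_noise hT hm hX (Ψ := fun y z => B.indicator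
    (fun y => M.dp ((T : ℝ) / m) n j (M.eulerStep ((T : ℝ) / m) y z)) y) hΨ
    (hint.indicator (hX' hB))).2
  rw [ProbabilityTheory.cond, integral_smul_measure, integral_smul_measure,
    ← integral_indicator (hX' hB), ← integral_indicator (hX' hB)]
  congr 1
  refine key.trans (integral_congr_ae (.of_forall fun ω => ?_))
  by_cases hω : X ω ∈ B
  · have hω' : ω ∈ X ⁻¹' B := hω
    simp only [Set.indicator_of_mem hω, Set.indicator_of_mem hω']
    rfl
  · have hω' : ω ∉ X ⁻¹' B := hω
    simp [Set.indicator_of_notMem hω, Set.indicator_of_notMem hω']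

/-- The largest error over the regimes with `n` remaining steps. -/
def Model.treeError (M : Model d q) (T : ℝ≥0) (m : ℕ) (P : Measure Ω) (Γ : ℕ → Finset (Vec d))
    (X Xhat : ℕ → Ω → Vec d) (n k : ℕ) (ω : Ω) : ℝ≥0∞ :=
  ⨆ i : Fin q, ‖M.dp ((T : ℝ) / m) n i (X k ω) - M.treeAux T m P Γ Xhat n i (Xhat k ω)‖ₑ

/-- The weighted quantization error. -/
def weightedError (X Xhat : ℕ → Ω → Vec d) (k : ℕ) (ω : Ω) : ℝ :=
  rho (Xhat k ω) * ‖X k ω - Xhat k ω‖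

lemma weightedError_nonneg (X Xhat : ℕ → Ω → Vec d) (k : ℕ) (ω : Ω) :
    0 ≤ weightedError X Xhat k ω := mul_nonneg (rho_nonneg _) (norm_nonneg _)

/-- The constant of one step of the error propagation. -/
def stepConst (d : ℕ) (L δ T : ℝ) : ℝ := contLip d L δ T + 2 * L

lemma stepConst_nonneg (hM : M.Regular L δ) : 0 ≤ stepConst d L δ T := by
  have := contLip_nonneg hM (T := T)
  have := hM.nonneg
  unfold stepConst; positivity

variable {Γ : ℕ → Finset (Vec d)} {π : ℕ → Vec d → Vec d}

/-- The continuation value at `X̄_k` is compared with that at `x = X̂_k`, and the latter with the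
conditional average used by the tree. The Lipschitz estimate for `cont` thus enters twice: once at
the given path, once averaged over its fibre. The error at the next date enters with factor one, so
constants do not compound. -/
lemma treeError_succ_le [IsProbabilityMeasure P] (hM : M.Regular L δ) (hW : IsBrownian 𝔽 P W)
    (hT : 0 < T) (hm : 1 ≤ m) (hh : (T : ℝ) / m ≤ 1) {X Xhat : ℕ → Ω → Vec d} {n k : ℕ}
    (hk : k + (n + 1) = m) (hX : Measurable[gridFiltration 𝔽 T m k] (X k))
    (hstep : ∀ ω, X (k + 1) ω = M.eulerStep ((T : ℝ) / m) (X k ω) (noise T m W k ω))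
    (hπ : Measurable (π k)) (hXhat : ∀ ω, Xhat k ω = π k (X k ω))
    (hmem : ∀ ω, Xhat k ω ∈ Γ k)
    (hYm : Measurable (Xhat (k + 1))) (hmem' : ∀ ω, Xhat (k + 1) ω ∈ Γ (k + 1))
    (hi : Integrable (fun ω => rho (X k ω)) P) (hi' : Integrable (fun ω => rho (X (k + 1) ω)) P) :
    ∀ᵐ ω ∂P, M.treeError T m P Γ X Xhat (n + 1) k ω ≤
      ENNReal.ofReal (stepConst d L δ T * weightedError X Xhat k ω) +
      condAvg P (Xhat k) (fun ω => ENNReal.ofReal (stepConst d L δ T * weightedError X Xhat k ω) +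
        M.treeError T m P Γ X Xhat n (k + 1) ω) ω := by
  have hX' : Measurable (X k) := hX.mono ((gridFiltration 𝔽 T m).le _) le_rfl
  have hXs : Measurable (X (k + 1)) := by
    rw [funext hstep]
    exact (hM.continuous_eulerStep _).measurable.comp (hX'.prodMk (hW.measurable_noise' k))
  have hYk : Measurable (Xhat k) := by
    rw [funext hXhat]; exact hπ.comp hX'
  have hh0 : 0 ≤ (T : ℝ) / m := by positivity
  have hmh : (m : ℝ) * ((T : ℝ) / m) = T := by
    have : (m : ℝ) ≠ 0 := by positivity
    field_simp
  have hn : (n : ℝ) * ((T : ℝ) / m) ≤ T := by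
    calc (n : ℝ) * ((T : ℝ) / m) ≤ m * ((T : ℝ) / m) := by
          gcongr; omega
      _ = T := hmh
  set h := (T : ℝ) / m with hhdef
  filter_upwards [ae_measure_fiber_ne_zero hmem (P := P)] with ω hω
  set x := Xhat k ω with hx
  set A := {ω' | Xhat k ω' = x} with hA
  have hAm : MeasurableSet A := measurableSet_fiber hYk x
  have hprob : IsProbabilityMeasure (P[|A]) := cond_isProbabilityMeasure hω
  have hApre : A = X k ⁻¹' (π k ⁻¹' {x}) := by
    ext ω'
    simp [hA, hXhat ω']
  have hC := contLip_nonneg hM (T := T)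
  have hL := hM.nonneg
  refine iSup_le fun i => ?_
  have : Nonempty (Fin q) := ⟨i⟩
  have htree : M.treeAux T m P Γ Xhat (n + 1) i x = ⨆ j : Fin q,
      ((∑ y ∈ Γ (k + 1), weight P Xhat k x y * M.treeAux T m P Γ Xhat n j y)
        + h * M.f j x - M.c i j x) := by
    simp only [Model.treeAux]
    rw [show m - n = k + 1 by omega, show m - (n + 1) = k by omega]
  rw [htree, M.dp_succ]
  refine enorm_iSup_sub_iSup_le _ _ fun j => ?_
  set S := ∑ y ∈ Γ (k + 1), weight P Xhat k x y * M.treeAux T m P Γ Xhat n j y with hS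
  have hSint : S = ∫ ω', M.treeAux T m P Γ Xhat n j (Xhat (k + 1) ω') ∂(P[|A]) :=
    (integral_comp_eq_sum hYm hmem' _).symm
  have hpoint : |(M.cont h n j (X k ω) + h * M.f j (X k ω) - M.c i j (X k ω)) -
      (M.cont h n j x + h * M.f j x - M.c i j x)| ≤
      stepConst d L δ T * weightedError X Xhat k ω := by
    have e1 := abs_cont_sub_le hM hh0 hh hn j (X k ω) x
    have e2 := hM.lip_f j (X k ω) x
    have e3 := hM.lip_c i j (X k ω) x
    have e4 : ‖X k ω - x‖ ≤ rho x * ‖X k ω - x‖ :=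
      le_mul_of_one_le_left (norm_nonneg _) (one_le_rho x)
    have e5 : |h * (M.f j (X k ω) - M.f j x)| ≤ L * ‖X k ω - x‖ := by
      rw [abs_mul, abs_of_nonneg hh0]
      calc _ ≤ 1 * |M.f j (X k ω) - M.f j x| := by gcongr
        _ ≤ _ := by rw [one_mul]; exact e2
    have e6 := mul_le_mul_of_nonneg_left e4 hL
    have e7 : (M.cont h n j (X k ω) + h * M.f j (X k ω) - M.c i j (X k ω)) -
        (M.cont h n j x + h * M.f j x - M.c i j x) =
        (M.cont h n j (X k ω) - M.cont h n j x) + h * (M.f j (X k ω) - M.f j x) -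
        (M.c i j (X k ω) - M.c i j x) := by ring
    rw [e7]
    refine (abs_sub _ _).trans ((add_le_add_left (abs_add_le _ _) _).trans ?_)
    unfold stepConst weightedError
    rw [← hx]
    linarith
  have icont : Integrable (fun ω' => M.cont h n j (X k ω')) (P[|A]) :=
    integrable_cond ((hi.const_mul _).mono'
      ((hM.measurable_cont n j).comp hX').aestronglyMeasurable
      (.of_forall fun ω' => abs_integral_comp_eulerStep_le hM hh0 hh
        (by have := momentRate_nonneg (d := d) hL; positivity)
        (abs_dp_le_pow hM hh0 hh n j) (X k ω') |>.trans_eq (mul_assoc _ _ _).symm)) hω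
  have idp : Integrable (fun ω' => M.dp h n j (X (k + 1) ω')) (P[|A]) :=
    integrable_cond ((hi'.const_mul _).mono'
      ((hM.measurable_dp n j).comp hXs).aestronglyMeasurable
      (.of_forall fun ω' => abs_dp_le_pow hM hh0 hh n j _)) hω
  have itree : Integrable (fun ω' => M.treeAux T m P Γ Xhat n j (Xhat (k + 1) ω')) (P[|A]) :=
    integrable_comp_of_finite hYm hmem' _
  have hnext : ∫ ω', M.dp h n j (X (k + 1) ω') ∂(P[|A]) =
      ∫ ω', M.cont h n j (X k ω') ∂(P[|A]) := by
    simp only [hstep]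
    rw [hApre]
    refine integral_cond_dp_next hM hW hT hm hh hX ?_ (hπ (measurableSet_singleton x))
    simpa only [hstep] using hi'
  -- Averaged over the fibre, the value at the next state equals the continuation value at the
  -- present one, so it can be inserted without changing the total.
  have hdiff : M.cont h n j x - S = ∫ ω', ((M.cont h n j x - M.cont h n j (X k ω')) +
      (M.dp h n j (X (k + 1) ω') -
        M.treeAux T m P Γ Xhat n j (Xhat (k + 1) ω'))) ∂(P[|A]) := by
    have i1 : Integrable (fun ω' => M.cont h n j x - M.cont h n j (X k ω')) (P[|A]) :=
      (integrable_const _).sub icont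
    have i2 : Integrable (fun ω' => M.dp h n j (X (k + 1) ω') -
        M.treeAux T m P Γ Xhat n j (Xhat (k + 1) ω')) (P[|A]) := idp.sub itree
    rw [integral_add i1 i2, integral_sub (integrable_const _) icont, integral_sub idp itree, hnext,
      ← hSint]
    simp
  have hcond : ‖M.cont h n j x - S‖ₑ ≤ condAvg P (Xhat k)
      (fun ω => ENNReal.ofReal (stepConst d L δ T * weightedError X Xhat k ω) +
        M.treeError T m P Γ X Xhat n (k + 1) ω) ω := by
    rw [hdiff]
    refine (enorm_integral_le_lintegral_enorm _).trans (lintegral_mono_ae ?_)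
    -- On the fibre all paths share the projection `x`, which is why the weight is placed at the
    -- projected point.
    filter_upwards [ae_cond_mem hAm] with ω' hω'
    refine (enorm_add_le _ _).trans (add_le_add ?_ ?_)
    · rw [Real.enorm_eq_ofReal_abs, abs_sub_comm]
      refine ENNReal.ofReal_le_ofReal ((abs_cont_sub_le hM hh0 hh hn j _ x).trans ?_)
      have e : Xhat k ω' = x := hω'
      unfold weightedError stepConst
      rw [e]
      have := rho_nonneg x
      gcongr
      linarith
    · exact le_iSup (fun i => ‖M.dp h n i (X (k + 1) ω') -
        M.treeAux T m P Γ Xhat n i (Xhat (k + 1) ω')‖ₑ) j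
  have hsplit : (M.cont h n j (X k ω) + h * M.f j (X k ω) - M.c i j (X k ω)) -
      (S + h * M.f j x - M.c i j x) =
      ((M.cont h n j (X k ω) + h * M.f j (X k ω) - M.c i j (X k ω)) -
      (M.cont h n j x + h * M.f j x - M.c i j x)) + (M.cont h n j x - S) := by ring
  rw [hsplit]
  refine (enorm_add_le _ _).trans (add_le_add ?_ hcond)
  rw [Real.enorm_eq_ofReal_abs]
  exact ENNReal.ofReal_le_ofReal hpoint

lemma treeError_zero_le (hM : M.Regular L δ) (X Xhat : ℕ → Ω → Vec d) (k : ℕ) (ω : Ω) :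
    M.treeError T m P Γ X Xhat 0 k ω ≤
      ENNReal.ofReal (stepConst d L δ T * weightedError X Xhat k ω) := by
  refine iSup_le fun i => ?_
  have hC := contLip_nonneg hM (T := T)
  have hL := hM.nonneg
  simp only [Model.dp, Model.treeAux]
  rw [Real.enorm_eq_ofReal_abs]
  refine ENNReal.ofReal_le_ofReal ((hM.lip_g i _ _).trans ?_)
  have e4 : ‖X k ω - Xhat k ω‖ ≤ rho (Xhat k ω) * ‖X k ω - Xhat k ω‖ :=
    le_mul_of_one_le_left (norm_nonneg _) (one_le_rho _)
  unfold stepConst weightedError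
  gcongr
  linarith

lemma eLpNorm_ofReal_mul_le {C : ℝ} (hC : 0 ≤ C) {Z : Ω → ℝ} (hZ : ∀ ω, 0 ≤ Z ω) (p : ℝ≥0∞) :
    eLpNorm (fun ω => ENNReal.ofReal (C * Z ω)) p P ≤ ENNReal.ofReal C * eLpNorm Z p P := by
  refine (eLpNorm_le_nnreal_smul_eLpNorm_of_ae_le_mul' (c := C.toNNReal) (g := Z)
    (.of_forall fun ω => ?_) p).trans_eq rfl
  rw [enorm_eq_self, ENNReal.ofReal_mul hC, Real.enorm_eq_ofReal (hZ ω)]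
  rfl

/-- The error of the quantization tree is controlled by the sum of the weighted quantization
errors. -/
lemma eLpNorm_treeError_le [IsProbabilityMeasure P] (hM : M.Regular L δ) (hW : IsBrownian 𝔽 P W)
    (hT : 0 < T) (hm : 1 ≤ m) (hh : (T : ℝ) / m ≤ 1) {X Xhat : ℕ → Ω → Vec d}
    (hX : ∀ k, Measurable[gridFiltration 𝔽 T m k] (X k))
    (hstep : ∀ k ω, X (k + 1) ω = M.eulerStep ((T : ℝ) / m) (X k ω) (noise T m W k ω))
    (hπ : ∀ k ≤ m, Measurable (π k)) (hXhat : ∀ k ω, Xhat k ω = π k (X k ω))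
    (hmem : ∀ k ≤ m, ∀ ω, Xhat k ω ∈ Γ k) {p : ℝ} (hp : 1 ≤ p) (n k : ℕ) (hk : k + n = m)
    (hi : ∀ l ∈ Finset.Icc k m, Integrable (fun ω => rho (X l ω)) P) :
    eLpNorm (M.treeError T m P Γ X Xhat n k) (ENNReal.ofReal p) P ≤
      2 * ENNReal.ofReal (stepConst d L δ T) *
        ∑ l ∈ Finset.Icc k m, eLpNorm (weightedError X Xhat l) (ENNReal.ofReal p) P := by
  have hX' : ∀ k, Measurable (X k) := fun k => (hX k).mono ((gridFiltration 𝔽 T m).le _) le_rfl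
  have hYm : ∀ k ≤ m, Measurable (Xhat k) := fun k hk => by
    rw [funext (hXhat k)]; exact (hπ k hk).comp (hX' k)
  have hS := stepConst_nonneg hM (T := T)
  have hp' : 1 ≤ ENNReal.ofReal p := ENNReal.one_le_ofReal.2 hp
  have hZm : ∀ k ≤ m, Measurable (weightedError X Xhat k) := fun k hk =>
    (continuous_rho.measurable.comp (hYm k hk)).mul ((hX' k).sub (hYm k hk)).norm
  have hZ'm : ∀ k ≤ m, Measurable (fun ω =>
      ENNReal.ofReal (stepConst d L δ T * weightedError X Xhat k ω)) := fun k hk =>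
    ((hZm k hk).const_mul _).ennreal_ofReal
  have hZ : ∀ k, eLpNorm (fun ω => ENNReal.ofReal (stepConst d L δ T * weightedError X Xhat k ω))
      (ENNReal.ofReal p) P ≤ ENNReal.ofReal (stepConst d L δ T) *
        eLpNorm (weightedError X Xhat k) (ENNReal.ofReal p) P := fun k =>
    eLpNorm_ofReal_mul_le hS (weightedError_nonneg X Xhat k) _
  have hEm : ∀ n, ∀ k ≤ m, Measurable (M.treeError T m P Γ X Xhat n k) := fun n k hk =>
    Measurable.iSup fun i => (((hM.measurable_dp n i).comp (hX' k)).sub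
      (measurable_comp_of_finite (hYm k hk) (hmem k hk) _)).enorm
  induction n generalizing k with
  | zero =>
    obtain rfl : k = m := by omega
    rw [Finset.Icc_self, Finset.sum_singleton]
    refine (eLpNorm_mono_enorm (g := fun ω => ENNReal.ofReal
      (stepConst d L δ T * weightedError X Xhat k ω)) fun ω => ?_).trans ((hZ k).trans ?_)
    · rw [enorm_eq_self, enorm_eq_self]
      exact treeError_zero_le hM X Xhat k ω
    · rw [mul_assoc]
      exact le_mul_of_one_le_left zero_le (by norm_num)
  | succ n ih =>
    have hkm : k ≤ m := by omega
    have hkm' : k + 1 ≤ m := by omega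
    have ih' := ih (k + 1) (by omega) fun l hl => hi l (by
      rw [Finset.mem_Icc] at hl ⊢; omega)
    set Z : Ω → ℝ≥0∞ := fun ω => ENNReal.ofReal (stepConst d L δ T * weightedError X Xhat k ω)
    set E := M.treeError T m P Γ X Xhat n (k + 1)
    have hrec := treeError_succ_le (Γ := Γ) (π := π) hM hW hT hm hh hk (hX k) (hstep k) (hπ k hkm)
      (hXhat k) (hmem k hkm) (hYm (k + 1) hkm') (hmem (k + 1) hkm')
      (hi k (by rw [Finset.mem_Icc]; omega)) (hi (k + 1) (by rw [Finset.mem_Icc]; omega))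
    have hcm : Measurable (condAvg P (Xhat k) (Z + E)) :=
      measurable_comp_of_finite (hYm k hkm) (hmem k hkm)
        (fun y => ∫⁻ ω', (Z + E) ω' ∂(P[|{ω' | Xhat k ω' = y}]))
    have h1 : eLpNorm (M.treeError T m P Γ X Xhat (n + 1) k) (ENNReal.ofReal p) P ≤
        eLpNorm (Z + condAvg P (Xhat k) (Z + E)) (ENNReal.ofReal p) P := by
      refine eLpNorm_mono_enorm_ae ?_
      filter_upwards [hrec] with ω hω
      rw [enorm_eq_self, enorm_eq_self]
      exact hω
    have h2 := eLpNorm_add_le (μ := P) (hZ'm k hkm).aestronglyMeasurable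
      hcm.aestronglyMeasurable hp'
    have h3 : eLpNorm (condAvg P (Xhat k) (Z + E)) (ENNReal.ofReal p) P ≤
        eLpNorm (Z + E) (ENNReal.ofReal p) P :=
      eLpNorm_condAvg_le (hYm k hkm) (hmem k hkm)
        ((hZ'm k hkm).add (hEm n (k + 1) hkm')) hp
    have h4 := eLpNorm_add_le (μ := P) (hZ'm k hkm).aestronglyMeasurable
      (hEm n (k + 1) hkm').aestronglyMeasurable hp'
    have hsum : ∑ l ∈ Finset.Icc k m, eLpNorm (weightedError X Xhat l) (ENNReal.ofReal p) P =
        eLpNorm (weightedError X Xhat k) (ENNReal.ofReal p) P +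
        ∑ l ∈ Finset.Icc (k + 1) m, eLpNorm (weightedError X Xhat l) (ENNReal.ofReal p) P := by
      rw [← Finset.insert_Icc_add_one_left_eq_Icc hkm, Finset.sum_insert (by simp)]
    rw [hsum]
    calc _ ≤ eLpNorm Z (ENNReal.ofReal p) P + (eLpNorm Z (ENNReal.ofReal p) P +
          eLpNorm E (ENNReal.ofReal p) P) :=
          h1.trans (h2.trans (add_le_add le_rfl (h3.trans h4)))
      _ ≤ _ + (_ + _) := add_le_add (hZ k) (add_le_add (hZ k) ih')
      _ = _ := by ring

lemma eLpNorm_mul_le {a b c : ℝ≥0∞} [ENNReal.HolderTriple a b c] {F G : Ω → ℝ}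
    (hF : AEStronglyMeasurable F P) (hG : AEStronglyMeasurable G P) :
    eLpNorm (fun ω => F ω * G ω) c P ≤ eLpNorm F a P * eLpNorm G b P := by
  have h := eLpNorm_le_eLpNorm_mul_eLpNorm_of_nnnorm (p := a) (q := b) (r := c) hF hG
    (fun x y => x * y) 1 (.of_forall fun ω => by rw [nnnorm_mul, one_mul])
  rwa [ENNReal.coe_one, one_mul] at h

lemma eLpNorm_weightedError_le [IsProbabilityMeasure P] {X Xhat : ℕ → Ω → Vec d} {l : ℕ}
    (hX : Measurable (X l)) (hY : Measurable (Xhat l)) {p r s : ℝ} (hp : 1 < p) (hr : 1 < r)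
    (hs : 1 < s) (hprs : 1 / p = 1 / r + 1 / s) :
    eLpNorm (weightedError X Xhat l) (ENNReal.ofReal p) P ≤
      (1 + eLpNorm (Xhat l) (ENNReal.ofReal r) P) *
        eLpNorm (fun ω => X l ω - Xhat l ω) (ENNReal.ofReal s) P := by
  have hH : ENNReal.HolderTriple (ENNReal.ofReal r) (ENNReal.ofReal s) (ENNReal.ofReal p) := by
    constructor
    rw [← ENNReal.ofReal_inv_of_pos (by linarith), ← ENNReal.ofReal_inv_of_pos (by linarith),
      ← ENNReal.ofReal_inv_of_pos (by linarith), ← ENNReal.ofReal_add (by positivity)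
      (by positivity)]
    congr 1
    simpa using hprs.symm
  have h1 : eLpNorm (weightedError X Xhat l) (ENNReal.ofReal p) P ≤
      eLpNorm (fun ω => rho (Xhat l ω)) (ENNReal.ofReal r) P *
        eLpNorm (fun ω => ‖X l ω - Xhat l ω‖) (ENNReal.ofReal s) P := by
    have h2 : AEStronglyMeasurable (fun ω => ‖X l ω - Xhat l ω‖) P :=
      (hX.sub hY).norm.aestronglyMeasurable
    have h3 : AEStronglyMeasurable (fun ω => rho (Xhat l ω)) P :=
      (continuous_rho.measurable.comp hY).aestronglyMeasurable
    exact eLpNorm_mul_le h3 h2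
  rw [eLpNorm_norm] at h1
  refine h1.trans ?_
  gcongr
  calc eLpNorm (fun ω => rho (Xhat l ω)) (ENNReal.ofReal r) P
      ≤ eLpNorm ((fun _ => (1 : ℝ)) + fun ω => ‖Xhat l ω‖) (ENNReal.ofReal r) P := by
        refine eLpNorm_mono_real fun ω => ?_
        rw [Real.norm_of_nonneg (rho_nonneg _)]
        exact rho_le _
    _ ≤ eLpNorm (fun _ => (1 : ℝ)) (ENNReal.ofReal r) P +
          eLpNorm (fun ω => ‖Xhat l ω‖) (ENNReal.ofReal r) P :=
        eLpNorm_add_le aestronglyMeasurable_const hY.norm.aestronglyMeasurable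
          (ENNReal.one_le_ofReal.2 hr.le)
    _ = _ := by
        rw [eLpNorm_norm, eLpNorm_const _ (by simpa using by linarith) (NeZero.ne P)]
        simp

end Quantization

end Switching

end

/-! ### Assembly of the estimates. -/

theorem theorem4p2 {d q : ℕ} (M : Switching.Model d q) (hM : M.Standing) (T : ℝ≥0) (hT : 0 < T) :
    ∃ K : ℝ, 0 < K ∧
      ∀ (Ω : Type*) (mΩ : MeasurableSpace Ω) (P : Measure Ω) (_ : IsProbabilityMeasure P)
        (𝔽 : Filtration ℝ≥0 mΩ) (W : ℝ≥0 → Ω → Switching.Vec d)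
        (_ : Switching.IsBrownian 𝔽 P W)
        (X₀ : Ω → Switching.Vec d) (_ : Measurable[𝔽 0] X₀)
        (m : ℕ) (_ : 1 ≤ m) (_ : (T : ℝ) / m ≤ 1)
        (Γ : ℕ → Finset (Switching.Vec d)) (π : ℕ → Switching.Vec d → Switching.Vec d)
        (_ : ∀ k ≤ m, Switching.IsNearestProj (Γ k) (π k)),
        let Xbar : ℕ → Ω → Switching.Vec d := M.euler T m W 0 X₀
        let Xhat : ℕ → Ω → Switching.Vec d := fun k ω => π k (Xbar k ω)
        let Ybar : Fin q → ℕ → Ω → ℝ := fun i k ω => M.value T m 𝔽 P W i k (Xbar k ω)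
        let Yhat : Fin q → ℕ → Ω → ℝ := fun i k ω => M.treeValue T m P Γ Xhat i k (Xhat k ω)
        ∀ k ≤ m, ∀ p r s : ℝ, 1 < p → 1 < r → 1 < s → 1 / p = 1 / r + 1 / s →
          (⨆ i : Fin q, eLpNorm (fun ω => Ybar i k ω - Yhat i k ω) (ENNReal.ofReal p) P) ≤
            ENNReal.ofReal K * ∑ ℓ ∈ Finset.Icc k m,
              (1 + eLpNorm X₀ (ENNReal.ofReal r) P + eLpNorm (Xhat ℓ) (ENNReal.ofReal r) P) *
                eLpNorm (fun ω => Xbar ℓ ω - Xhat ℓ ω) (ENNReal.ofReal s) P := by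
  obtain ⟨L, δ, hR⟩ := hM.exists_regular
  have hS := Switching.stepConst_nonneg hR (T := T)
  -- The `+ 1` only ensures strict positivity.
  refine ⟨2 * Switching.stepConst d L δ T + 1, by positivity, ?_⟩
  intro Ω mΩ P hP 𝔽 W hW X₀ hX₀ m hm hh Γ π hπ Xbar Xhat Ybar Yhat k hk p r s hp hr hs hprs
  have hX₀' : Measurable[Switching.gridFiltration 𝔽 T m 0] X₀ := by
    have h0 : Switching.gridTime T m 0 = 0 := by simp [Switching.gridTime]
    change Measurable[𝔽 (Switching.gridTime T m 0)] X₀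
    rw [h0]
    exact hX₀
  have hX : ∀ n, Measurable[Switching.gridFiltration 𝔽 T m n] (Xbar n) := fun n => by
    have := Switching.measurable_euler hR hW hX₀' n
    rwa [Nat.zero_add] at this
  have hX' : ∀ n, Measurable (Xbar n) := fun n =>
    (hX n).mono ((Switching.gridFiltration 𝔽 T m).le _) le_rfl
  have hY : ∀ n ≤ m, Measurable (Xhat n) := fun n hn => (hπ n hn).measurable.comp (hX' n)
  have hmem : ∀ n ≤ m, ∀ ω, Xhat n ω ∈ Γ n := fun n hn ω => (hπ n hn).mem _
  -- If some quantization error has infinite norm, the right-hand side is infinite, since its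
  -- prefactor is at least one and `K > 0`.
  by_cases htop : ∃ l ∈ Finset.Icc k m,
      eLpNorm (fun ω => Xbar l ω - Xhat l ω) (ENNReal.ofReal s) P = ∞
  · obtain ⟨l, hl, htop⟩ := htop
    have hsum : ∑ ℓ ∈ Finset.Icc k m,
        (1 + eLpNorm X₀ (ENNReal.ofReal r) P + eLpNorm (Xhat ℓ) (ENNReal.ofReal r) P) *
          eLpNorm (fun ω => Xbar ℓ ω - Xhat ℓ ω) (ENNReal.ofReal s) P = ∞ := by
      refine ENNReal.sum_eq_top.2 ⟨l, hl, ?_⟩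
      rw [htop]
      exact ENNReal.mul_top (by simp)
    rw [hsum, ENNReal.mul_top (by simpa using by positivity)]
    exact le_top
  push Not at htop
  -- No moment of `X₀` is assumed: `X̄_l` is integrable as the sum of the integrable error and the
  -- bounded projection.
  have hi : ∀ l ∈ Finset.Icc k m, Integrable (fun ω => Switching.rho (Xbar l ω)) P := by
    intro l hl
    have hlm := (Finset.mem_Icc.1 hl).2
    have hdiff : MemLp (fun ω => Xbar l ω - Xhat l ω) (ENNReal.ofReal s) P :=
      ⟨((hX' l).sub (hY l hlm)).aestronglyMeasurable, (htop l hl).lt_top⟩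
    have hsum := (hdiff.integrable (ENNReal.one_le_ofReal.2 hs.le)).add
      (Switching.integrable_comp_of_finite (hY l hlm) (hmem l hlm) id)
    refine Switching.integrable_rho_of_norm (hsum.congr (.of_forall fun ω => ?_))
    simp
  have key := Switching.eLpNorm_treeError_le (Γ := Γ) (π := π) hR hW hT hm hh hX
    (fun n ω => by
      change M.eulerStep _ _ (Switching.noise T m W (0 + n) ω) = _
      rw [Nat.zero_add])
    (fun n hn => (hπ n hn).measurable) (fun _ _ => rfl) hmem hp.le (m - k) k (by omega) hi
  refine (iSup_le fun i => ?_).trans (key.trans ?_)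
  · refine eLpNorm_mono_enorm fun ω => ?_
    rw [enorm_eq_self]
    simp only [Ybar, Yhat, Switching.Model.treeValue,
      Switching.value_eq_dp hR hW hT hm hh hk]
    exact le_iSup (fun i => ‖M.dp ((T : ℝ) / m) (m - k) i (Xbar k ω) -
      M.treeAux T m P Γ Xhat (m - k) i (Xhat k ω)‖ₑ) i
  · refine mul_le_mul' ?_ (Finset.sum_le_sum fun l hl => ?_)
    · rw [show (2 : ℝ≥0∞) = ENNReal.ofReal 2 by simp, ← ENNReal.ofReal_mul (by norm_num)]
      exact ENNReal.ofReal_le_ofReal (by linarith)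
    · refine (Switching.eLpNorm_weightedError_le (hX' l) (hY l (Finset.mem_Icc.1 hl).2)
        hp hr hs hprs).trans ?_
      gcongr
      exact le_self_add
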